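/- Let $\mathcal{P}$ be $\mathcal{G}$ or $\mathcal{M}$, where $\mathcal{P}(1,1)$ is the set of nondecreasing homeomorphisms of $[0,1]$ if $\mathcal{P}=\mathcal{G}$, and the set of nondecreasing continuous surjections $[0,1]\to[0,1]$ if $\mathcal{P}=\mathcal{M}$. All spaces are $\Delta$-generated (or, alternatively, $\Delta$-Hausdorff and $\Delta$-generated; the result holds with either convention). A $\mathcal{P}$-multipointed $d$-space $X$ is a space $|X|$ with a subset $X^0$ of states and a set of continuous maps $[0,1]\to|X|$, the execution paths, which start and end in $X^0$ and are closed under precomposition with $\mathcal{P}(1,1)$ and under normalized composition; maps are the continuous maps preserving states and execution paths. For a space $Z$, the globe $\mathrm{Glob}^{\mathcal{P}}(Z)$ has as underlying space the quotient of $\{0,1\}\sqcup (Z\times[0,1])$ by $(z,0)=0$ and $(z,1)=1$, has states $0,1$, and has execution paths $\delta_z\phi$ with $z\in Z$, $\phi\in\mathcal{P}(1,1)$ and $\delta_z(t)=(z,t)$. Let $X_\lambda$ be a cellular $\mathcal{P}$-multipointed $d$-space: the colimit of a colimit-preserving transfinite tower $(X_\nu)$ indexed by a well-ordered set, where $X_0=(X^0,X^0,\varnothing)$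 is a (discrete) set and each $X_{\nu+1}$ is obtained from $X_\nu$ by a pushout of $\mathrm{Glob}^{\mathcal{P}}(\mathbf{S}^{n_\nu-1})\subset \mathrm{Glob}^{\mathcal{P}}(\mathbf{D}^{n_\nu})$ along some map, with $n_\nu\ge 0$ and $\mathbf{S}^{-1}=\varnothing$. Write $\widehat{g_\nu}:\mathrm{Glob}^{\mathcal{P}}(\mathbf{D}^{n_\nu})\to X_\lambda$ for the resulting map and $c_\nu$ for the $\nu$-th globular cell. A carrier of an execution path $\gamma$ of $X_\lambda$ is a finite sequence $[c_{\nu_1},\dots,c_{\nu_n}]$ of globular cells, $n\ge 1$, such that $\gamma$ is a Moore composition $$\gamma=(\widehat{g_{\nu_1}}\delta_{z_1}\phi_1\mu_{\ell_1})*\dots*(\widehat{g_{\nu_n}}\delta_{z_n}\phi_n\mu_{\ell_n})$$ with $z_i\in\mathbf{D}^{n_{\nu_i}}\setminus\mathbf{S}^{n_{\nu_i}-1}$, $\phi_i\in\mathcal{P}(1,1)$, $\ell_i>0$, $\sum_i\ell_i=1$, where $\mu_\ell:[0,\ell]\to[0,1]$ is $t\mapsto t/\ell$. **Theorem.** Let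 $\alpha,\beta\in X^0$ and let $(\gamma_n)_{n\ge 0}$ be a sequence of execution paths of $X_\lambda$ from $\alpha$ to $\beta$ which converges, in the set of execution paths from $\alpha$ to $\beta$ equipped with the compact-open topology, to an execution path $\gamma_\infty$. Then each $\gamma_n$ has exactly one carrier, denoted $\mathrm{Carrier}(\gamma_n)$, and the set $\{\mathrm{Carrier}(\gamma_n)\mid n\ge 0\}$ is finite. -/

import Mathlib

open CategoryTheory CategoryTheory.Limits Topology Filter

universe u

/-! ### The ambient category of spaces -/

/-- The two conventions for the ambient category of topological spaces: `Δ`-generated spaces,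
or `Δ`-Hausdorff `Δ`-generated spaces. -/
inductive SpaceConvention
  | deltaGenerated
  | deltaHausdorff

/-- A space is `Δ`-Hausdorff if every continuous image of the segment `[0,1]` in it is closed. -/
def DeltaHausdorff (X : Type*) [TopologicalSpace X] : Prop :=
  ∀ f : C(unitInterval, X), IsClosed (Set.range f)

/-- `T.Holds X`: the space `X` belongs to the category of spaces selected by `T`. -/
def SpaceConvention.Holds (T : SpaceConvention) (X : Type*) [TopologicalSpace X] : Prop :=
  match T with
  | .deltaGenerated => DeltaGeneratedSpace X
  | .deltaHausdorff => DeltaGeneratedSpace X ∧ DeltaHausdorff X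

theorem SpaceConvention.holds_of_t2 (T : SpaceConvention) (X : Type*) [TopologicalSpace X]
    [T2Space X] (h : DeltaGeneratedSpace X) : T.Holds X := by
  cases T with
  | deltaGenerated => exact h
  | deltaHausdorff => exact ⟨h, fun f => (isCompact_range f.continuous).isClosed⟩

theorem deltaGeneratedSpace_of_isOpen {X : Type*} [TopologicalSpace X]
    (H : ∀ U : Set X, (∀ (n : ℕ) (f : C(Fin n → ℝ, X)), IsOpen (f ⁻¹' U)) → IsOpen U) :
    DeltaGeneratedSpace X := by
  refine ⟨⟨fun U hU => H _ fun n f => ?_⟩⟩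
  exact (WithGeneratedByTopology.isOpen_iff (X := fun n => Fin n → ℝ)).1 hU f

theorem deltaGeneratedSpace_of_local_retract {X : Type*} [TopologicalSpace X]
    {E : Type*} [NormedAddCommGroup E] [NormedSpace ℝ E] [FiniteDimensional ℝ E]
    (H : ∀ p : X, ∃ (f : C(E, X)) (g : X → E),
      ContinuousAt g p ∧ ∀ᶠ x in 𝓝 p, f (g x) = x) : DeltaGeneratedSpace X := by
  refine deltaGeneratedSpace_of_isOpen fun U hU => isOpen_iff_mem_nhds.2 fun p hp => ?_
  obtain ⟨f, g, hg, hfg⟩ := H p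
  let e : E ≃L[ℝ] (Fin (Module.finrank ℝ E) → ℝ) :=
    ContinuousLinearEquiv.ofFinrankEq (by simp)
  have h0 : IsOpen (f ⁻¹' U) := by
    have h := hU _ (f.comp ⟨e.symm, e.symm.continuous⟩)
    have h2 := h.preimage e.continuous
    convert h2 using 1
    ext x
    simp
  have h1 : f ⁻¹' U ∈ 𝓝 (g p) := h0.mem_nhds (by simpa [hfg.self_of_nhds] using hp)
  filter_upwards [hg h1, hfg] with x hx hx'
  have : f (g x) ∈ U := hx
  rwa [hx'] at this

theorem deltaGeneratedSpace_of_discrete (X : Type*) [TopologicalSpace X] [DiscreteTopology X] :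
    DeltaGeneratedSpace X :=
  deltaGeneratedSpace_of_isOpen fun _ _ => isOpen_discrete _

/-- The closed Euclidean unit disk of dimension `n`. -/
abbrev Disk (n : ℕ) : Type u :=
  ULift.{u} (Metric.closedBall (0 : EuclideanSpace ℝ (Fin n)) 1)

/-- The boundary of the disk of dimension `n`, i.e. the sphere of dimension `n - 1`; it is empty
for `n = 0`. -/
abbrev DiskBoundary (n : ℕ) : Type u :=
  ULift.{u} (Metric.sphere (0 : EuclideanSpace ℝ (Fin n)) 1)

/-- The inclusion of the boundary of the disk in the disk. -/
def diskIncl (n : ℕ) : C(DiskBoundary.{u} n, Disk.{u} n) where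
  toFun z := ⟨⟨z.down.1, Metric.sphere_subset_closedBall z.down.2⟩⟩
  continuous_toFun := by fun_prop

theorem deltaGeneratedSpace_disk_prod (n : ℕ) :
    DeltaGeneratedSpace (Disk.{u} n × unitInterval) := by
  refine deltaGeneratedSpace_of_local_retract (E := EuclideanSpace ℝ (Fin n) × ℝ) fun p => ?_
  refine ⟨⟨fun v => (⟨⟨(max 1 ‖v.1‖)⁻¹ • v.1, ?_⟩⟩, Set.projIcc 0 1 zero_le_one v.2), ?_⟩,
    fun x => (x.1.down.1, x.2.1), ?_, Eventually.of_forall fun x => ?_⟩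
  · have h : (0 : ℝ) < max 1 ‖v.1‖ := lt_max_of_lt_left one_pos
    rw [mem_closedBall_zero_iff, norm_smul, norm_inv, Real.norm_of_nonneg h.le,
      inv_mul_le_iff₀ h, mul_one]
    exact le_max_right _ _
  · have h : ∀ v : EuclideanSpace ℝ (Fin n) × ℝ, max 1 ‖v.1‖ ≠ 0 := fun v =>
      (lt_max_of_lt_left one_pos).ne'
    have h2 : Continuous fun v : EuclideanSpace ℝ (Fin n) × ℝ => (max 1 ‖v.1‖)⁻¹ • v.1 :=
      ((continuous_const.max (continuous_norm.comp continuous_fst)).inv₀ h).smul continuous_fst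
    exact (continuous_uliftUp.comp (h2.subtype_mk _)).prodMk
      (continuous_projIcc.comp continuous_snd)
  · exact Continuous.continuousAt (by fun_prop)
  · obtain ⟨⟨⟨x, hx⟩⟩, t⟩ := x
    have : max 1 ‖x‖ = 1 := max_eq_left (by simpa using hx)
    simp [this]

theorem deltaGeneratedSpace_diskBoundary_prod (n : ℕ) :
    DeltaGeneratedSpace (DiskBoundary.{u} n × unitInterval) := by
  refine deltaGeneratedSpace_of_local_retract (E := EuclideanSpace ℝ (Fin n) × ℝ) fun p => ?_
  obtain ⟨⟨⟨p, hp⟩⟩, s⟩ := p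
  have hp1 : ‖p‖ = 1 := by simpa using hp
  let h : EuclideanSpace ℝ (Fin n) → EuclideanSpace ℝ (Fin n) :=
    fun v => p + (max 1 (2 * ‖v‖))⁻¹ • v
  have hpos : ∀ v : EuclideanSpace ℝ (Fin n), (0 : ℝ) < max 1 (2 * ‖v‖) := fun v =>
    lt_max_of_lt_left one_pos
  have hne : ∀ v, h v ≠ 0 := by
    intro v hv
    have h1 : ‖(max 1 (2 * ‖v‖))⁻¹ • v‖ ≤ 1 / 2 := by
      rw [norm_smul, norm_inv, Real.norm_of_nonneg (hpos v).le, inv_mul_le_iff₀ (hpos v)]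
      have := le_max_right 1 (2 * ‖v‖)
      linarith
    have h2 : p = -((max 1 (2 * ‖v‖))⁻¹ • v) := eq_neg_of_add_eq_zero_left hv
    rw [← norm_neg, ← h2, hp1] at h1
    norm_num at h1
  have hc : Continuous h := by
    have h2 : Continuous fun v : EuclideanSpace ℝ (Fin n) => (max 1 (2 * ‖v‖))⁻¹ • v :=
      ((continuous_const.max (continuous_const.mul continuous_norm)).inv₀
        fun v => (hpos v).ne').smul continuous_id
    exact continuous_const.add h2
  refine ⟨⟨fun v => (⟨⟨‖h v.1‖⁻¹ • h v.1, ?_⟩⟩, Set.projIcc 0 1 zero_le_one v.2), ?_⟩,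
    fun x => (x.1.down.1 - p, x.2.1), ?_, ?_⟩
  · rw [mem_sphere_zero_iff_norm, norm_smul, norm_inv, norm_norm,
      inv_mul_cancel₀ (norm_ne_zero_iff.2 (hne _))]
  · have h2 : Continuous fun v : EuclideanSpace ℝ (Fin n) × ℝ => ‖h v.1‖⁻¹ • h v.1 :=
      ((hc.comp continuous_fst).norm.inv₀ fun v => norm_ne_zero_iff.2 (hne _)).smul
        (hc.comp continuous_fst)
    exact (continuous_uliftUp.comp (h2.subtype_mk _)).prodMk
      (continuous_projIcc.comp continuous_snd)
  · exact Continuous.continuousAt (by fun_prop)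
  · have hd : Continuous fun x : DiskBoundary.{u} n × unitInterval => ‖x.1.down.1 - p‖ := by
      fun_prop
    have hev := hd.continuousAt.eventually_lt (x₀ := (⟨⟨p, hp⟩⟩, s))
      (continuousAt_const (y := (1 / 2 : ℝ))) (by simp)
    filter_upwards [hev] with x hx
    obtain ⟨⟨⟨x, hx'⟩⟩, t⟩ := x
    have hm : max 1 (2 * ‖x - p‖) = 1 := max_eq_left (by simp at hx; linarith)
    have hx1 : ‖x‖ = 1 := by simpa using hx'
    have hh : h (x - p) = x := by simp [h, hm]
    simp [hh, hx1]

/-! ### Multipointed d-spaces -/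

/-- The two reparametrization categories `𝒢` and `ℳ`. -/
inductive ReparamCategory
  | G
  | M

/-- The set of maps `𝒫(1,1)`: the nondecreasing homeomorphisms of `[0,1]` for `𝒢`, the
nondecreasing continuous surjections from `[0,1]` to itself for `ℳ`. -/
def ReparamCategory.maps (P : ReparamCategory) : Set C(unitInterval, unitInterval) :=
  match P with
  | .G => {φ | Monotone φ ∧ IsHomeomorph φ}
  | .M => {φ | Monotone φ ∧ Function.Surjective φ}

theorem ReparamCategory.monotone_surjective {P : ReparamCategory}
    {φ : C(unitInterval, unitInterval)} (h : φ ∈ P.maps) :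
    Monotone φ ∧ Function.Surjective φ := by
  cases P with
  | G => exact ⟨h.1, h.2.surjective⟩
  | M => exact h

theorem ReparamCategory.map_zero {P : ReparamCategory} {φ : C(unitInterval, unitInterval)}
    (h : φ ∈ P.maps) : φ 0 = 0 := by
  obtain ⟨hm, hs⟩ := ReparamCategory.monotone_surjective h
  obtain ⟨t, ht⟩ := hs 0
  exact le_antisymm ((hm unitInterval.nonneg').trans ht.le) unitInterval.nonneg'

theorem ReparamCategory.map_one {P : ReparamCategory} {φ : C(unitInterval, unitInterval)}
    (h : φ ∈ P.maps) : φ 1 = 1 := by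
  obtain ⟨hm, hs⟩ := ReparamCategory.monotone_surjective h
  obtain ⟨t, ht⟩ := hs 1
  exact le_antisymm unitInterval.le_one' (ht.ge.trans (hm unitInterval.le_one'))

theorem ReparamCategory.comp_mem {P : ReparamCategory} {φ ψ : C(unitInterval, unitInterval)}
    (h : φ ∈ P.maps) (h' : ψ ∈ P.maps) : φ.comp ψ ∈ P.maps := by
  cases P with
  | G => exact ⟨h.1.comp h'.1, h.2.comp h'.2⟩
  | M => exact ⟨h.1.comp h'.1, h.2.comp h'.2⟩

/-- The normalized composition `γ₁ *_N γ₂`: it is `γ₁ (2 t)` for `t ≤ 1/2` and `γ₂ (2 t - 1)` for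
`1/2 ≤ t`. -/
noncomputable def normalizedComp {X : Type*} [TopologicalSpace X] (γ₁ γ₂ : C(unitInterval, X))
    (h : γ₁ 1 = γ₂ 0) : C(unitInterval, X) :=
  (Path.trans (⟨γ₁, rfl, rfl⟩ : Path (γ₁ 0) (γ₁ 1))
    (⟨γ₂, h.symm, rfl⟩ : Path (γ₁ 1) (γ₂ 1))).toContinuousMap

/-- A `P`-multipointed d-space whose underlying space satisfies the convention `T`: a space
equipped with a set of states and a set of execution paths between states, closed under
reparametrization and under normalized composition. -/
structure MultipointedDSpace (P : ReparamCategory) (T : SpaceConvention) where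
  /-- the underlying space -/
  carrier : Type u
  [top : TopologicalSpace carrier]
  holds : T.Holds carrier
  states : Set carrier
  execPaths : Set C(unitInterval, carrier)
  source_mem : ∀ γ ∈ execPaths, γ 0 ∈ states
  target_mem : ∀ γ ∈ execPaths, γ 1 ∈ states
  reparam_mem : ∀ γ ∈ execPaths, ∀ φ ∈ P.maps, γ.comp φ ∈ execPaths
  comp_mem : ∀ γ₁ ∈ execPaths, ∀ γ₂ ∈ execPaths, ∀ h : γ₁ 1 = γ₂ 0,
    normalizedComp γ₁ γ₂ h ∈ execPaths

namespace MultipointedDSpace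

attribute [instance] MultipointedDSpace.top

variable {P : ReparamCategory} {T : SpaceConvention}

/-- The maps of multipointed d-spaces: the continuous maps preserving states and execution
paths. -/
@[ext]
structure Hom (X Y : MultipointedDSpace.{u} P T) where
  toMap : C(X.carrier, Y.carrier)
  map_states : ∀ x ∈ X.states, toMap x ∈ Y.states
  map_execPaths : ∀ γ ∈ X.execPaths, toMap.comp γ ∈ Y.execPaths

instance : Category (MultipointedDSpace.{u} P T) where
  Hom := Hom
  id X := ⟨ContinuousMap.id _, fun _ h => h, fun _ h => h⟩
  comp f g := ⟨g.toMap.comp f.toMap, fun x h => g.map_states _ (f.map_states x h),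
    fun γ h => g.map_execPaths _ (f.map_execPaths γ h)⟩

/-- The multipointed d-space `(E, E, ∅)` given by a set `E`. -/
def ofSet (P : ReparamCategory) (T : SpaceConvention) (E : Type u) :
    MultipointedDSpace.{u} P T :=
  letI : TopologicalSpace E := ⊥
  haveI : DiscreteTopology E := ⟨rfl⟩
  { carrier := E
    holds := T.holds_of_t2 E (deltaGeneratedSpace_of_discrete E)
    states := Set.univ
    execPaths := ∅
    source_mem := by simp
    target_mem := by simp
    reparam_mem := by simp
    comp_mem := by simp }

/-- The set `P^{top}_{α,β} X` of execution paths from `α` to `β`. As a subtype of a space of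
continuous maps, it carries the relative topology of the compact-open topology. -/
abbrev ExecPath (X : MultipointedDSpace.{u} P T) (α β : X.states) : Type u :=
  {γ : C(unitInterval, X.carrier) // γ ∈ X.execPaths ∧ γ 0 = α ∧ γ 1 = β}

end MultipointedDSpace

/-! ### Globes -/

/-- The identifications `(z,0) = 0` and `(z,1) = 1` in `{0,1} ⊔ (Z × [0,1])`. -/
inductive GlobRel (Z : Type u) : Fin 2 ⊕ (Z × unitInterval) → Fin 2 ⊕ (Z × unitInterval) → Prop
  | zero (z : Z) : GlobRel Z (Sum.inr (z, 0)) (Sum.inl 0)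
  | one (z : Z) : GlobRel Z (Sum.inr (z, 1)) (Sum.inl 1)

/-- The underlying space of the globe of `Z`, with the quotient topology. It is used only for
compact disks and spheres `Z`, where the product `Z × [0,1]` is already `Δ`-generated. -/
abbrev GlobSpace (Z : Type u) [TopologicalSpace Z] : Type u := Quot (GlobRel Z)

namespace GlobSpace

/-- The states `0` and `1` of the globe. -/
def state (Z : Type u) [TopologicalSpace Z] (i : Fin 2) : GlobSpace Z := Quot.mk _ (Sum.inl i)

/-- The point `(z,t)` of the globe. -/
def mk {Z : Type u} [TopologicalSpace Z] (z : Z) (t : unitInterval) : GlobSpace Z :=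
  Quot.mk _ (Sum.inr (z, t))

theorem continuous_mk {Z : Type u} [TopologicalSpace Z] :
    Continuous fun p : Z × unitInterval => mk p.1 p.2 :=
  continuous_quot_mk.comp continuous_inr

theorem mk_zero {Z : Type u} [TopologicalSpace Z] (z : Z) : mk z 0 = state Z 0 :=
  Quot.sound (GlobRel.zero z)

theorem mk_one {Z : Type u} [TopologicalSpace Z] (z : Z) : mk z 1 = state Z 1 :=
  Quot.sound (GlobRel.one z)

/-- The path `δ_z : t ↦ (z,t)` of the globe. -/
def delta {Z : Type u} [TopologicalSpace Z] (z : Z) : C(unitInterval, GlobSpace Z) where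
  toFun t := mk z t
  continuous_toFun := continuous_mk.comp (by fun_prop : Continuous fun t => (z, t))

/-- The continuous map between globes induced by a continuous map. -/
def map {Z W : Type u} [TopologicalSpace Z] [TopologicalSpace W] (f : C(Z, W)) :
    C(GlobSpace Z, GlobSpace W) where
  toFun := Quot.lift (fun p => Sum.elim (state W) (fun q => mk (f q.1) q.2) p) (by
    rintro _ _ (z | z)
    · exact mk_zero (f z)
    · exact mk_one (f z))
  continuous_toFun := by
    refine continuous_quot_lift _ (Continuous.sumElim (by fun_prop) ?_)
    exact continuous_mk.comp (by fun_prop : Continuous fun q : Z × unitInterval => (f q.1, q.2))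

theorem t2Space {Z : Type u} [TopologicalSpace Z] {E : Type*} [NormedAddCommGroup E]
    [NormedSpace ℝ E] (ι : C(Z, E)) (hι : Function.Injective ι) : T2Space (GlobSpace Z) := by
  let F₀ : Fin 2 ⊕ (Z × unitInterval) → E × ℝ :=
    Sum.elim (fun i => (0, (i.1 : ℝ))) fun q => (((q.2 : ℝ) * (1 - q.2)) • ι q.1, (q.2 : ℝ))
  have hF₀ : Continuous F₀ := Continuous.sumElim (by fun_prop) (by fun_prop)
  let F : GlobSpace Z → E × ℝ := Quot.lift F₀ (by
    rintro _ _ (z | z) <;> simp [F₀])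
  have hF : Continuous F := continuous_quot_lift _ hF₀
  have key : ∀ x : GlobSpace Z, (∃ i, x = state Z i) ∨
      ∃ z, ∃ t : unitInterval, 0 < t ∧ t < 1 ∧ x = mk z t := by
    rintro ⟨i | ⟨z, t⟩⟩
    · exact Or.inl ⟨i, rfl⟩
    · rcases eq_or_lt_of_le (unitInterval.nonneg' (t := t)) with h | h
      · exact Or.inl ⟨0, h ▸ mk_zero z⟩
      · rcases eq_or_lt_of_le (unitInterval.le_one' (t := t)) with h' | h'
        · exact Or.inl ⟨1, h' ▸ mk_one z⟩
        · exact Or.inr ⟨z, t, h, h', rfl⟩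
  refine T2Space.of_injective_continuous (f := F) (fun x y hxy => ?_) hF
  have e1 : ∀ i, F (state Z i) = (0, (i.1 : ℝ)) := fun i => rfl
  have e2 : ∀ z (t : unitInterval), F (mk z t) = (((t : ℝ) * (1 - t)) • ι z, (t : ℝ)) :=
    fun z t => rfl
  rcases key x with ⟨i, rfl⟩ | ⟨z, t, h0, h1, rfl⟩ <;>
    rcases key y with ⟨j, rfl⟩ | ⟨w, s, g0, g1, rfl⟩
  · simp only [e1, Prod.mk.injEq, true_and, Nat.cast_inj] at hxy
    rw [Fin.ext hxy]
  · exfalso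
    have := congrArg Prod.snd hxy
    simp only [e1, e2] at this
    have g0' : (0 : ℝ) < s := g0
    have g1' : (s : ℝ) < 1 := g1
    fin_cases i <;> simp at this <;> linarith
  · exfalso
    have := congrArg Prod.snd hxy
    simp only [e1, e2] at this
    have g0' : (0 : ℝ) < t := h0
    have g1' : (t : ℝ) < 1 := h1
    fin_cases j <;> simp at this <;> simp [this] at g0' g1'
  · simp only [e2, Prod.mk.injEq] at hxy
    obtain ⟨ha, hb⟩ := hxy
    have hts : t = s := Subtype.ext hb
    subst hts
    have g0' : (0 : ℝ) < t := h0
    have g1' : (t : ℝ) < 1 := h1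
    have hne : (t : ℝ) * (1 - t) ≠ 0 := (mul_pos g0' (by linarith)).ne'
    rw [hι (smul_right_injective E hne ha)]

theorem state_zero_ne_one (Z : Type u) [TopologicalSpace Z] : state Z 0 ≠ state Z 1 := by
  intro h
  let F : GlobSpace Z → ℝ := Quot.lift
    (Sum.elim (fun i => (i.1 : ℝ)) fun q => (q.2 : ℝ)) (by rintro _ _ (z | z) <;> simp)
  have h' : F (state Z 0) = F (state Z 1) := congrArg F h
  have h0 : F (state Z 0) = 0 := by
    change (((0 : Fin 2) : ℕ) : ℝ) = 0
    simp
  have h1 : F (state Z 1) = 1 := by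
    change (((1 : Fin 2) : ℕ) : ℝ) = 1
    simp
  rw [h0, h1] at h'
  exact zero_ne_one h'

theorem holds_disk (T : SpaceConvention) (n : ℕ) : T.Holds (GlobSpace (Disk.{u} n)) :=
  haveI := deltaGeneratedSpace_disk_prod.{u} n
  haveI := deltaGeneratedSpace_of_discrete (Fin 2)
  haveI : T2Space (GlobSpace (Disk.{u} n)) :=
    t2Space (E := EuclideanSpace ℝ (Fin n)) ⟨fun z => z.down.1, by fun_prop⟩
      (Subtype.val_injective.comp ULift.down_injective)
  T.holds_of_t2 _ inferInstance

theorem holds_diskBoundary (T : SpaceConvention) (n : ℕ) :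
    T.Holds (GlobSpace (DiskBoundary.{u} n)) :=
  haveI := deltaGeneratedSpace_diskBoundary_prod.{u} n
  haveI := deltaGeneratedSpace_of_discrete (Fin 2)
  haveI : T2Space (GlobSpace (DiskBoundary.{u} n)) :=
    t2Space (E := EuclideanSpace ℝ (Fin n)) ⟨fun z => z.down.1, by fun_prop⟩
      (Subtype.val_injective.comp ULift.down_injective)
  T.holds_of_t2 _ inferInstance

end GlobSpace

namespace MultipointedDSpace

variable {P : ReparamCategory} {T : SpaceConvention}

/-- The topological globe of `Z`: its states are `0` and `1`, and its execution paths are the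
paths `δ_z φ` with `z ∈ Z` and `φ ∈ 𝒫(1,1)`. -/
def glob (P : ReparamCategory) (T : SpaceConvention) (Z : Type u) [TopologicalSpace Z]
    (hZ : T.Holds (GlobSpace Z)) : MultipointedDSpace.{u} P T where
  carrier := GlobSpace Z
  holds := hZ
  states := Set.range (GlobSpace.state Z)
  execPaths := {γ | ∃ z, ∃ φ ∈ P.maps, γ = (GlobSpace.delta z).comp φ}
  source_mem := by
    rintro _ ⟨z, φ, hφ, rfl⟩
    refine ⟨0, ?_⟩
    rw [ContinuousMap.comp_apply, ReparamCategory.map_zero hφ]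
    exact (GlobSpace.mk_zero z).symm
  target_mem := by
    rintro _ ⟨z, φ, hφ, rfl⟩
    refine ⟨1, ?_⟩
    rw [ContinuousMap.comp_apply, ReparamCategory.map_one hφ]
    exact (GlobSpace.mk_one z).symm
  reparam_mem := by
    rintro _ ⟨z, φ, hφ, rfl⟩ ψ hψ
    exact ⟨z, φ.comp ψ, ReparamCategory.comp_mem hφ hψ, rfl⟩
  comp_mem := by
    rintro _ ⟨z, φ, hφ, rfl⟩ _ ⟨w, ψ, hψ, rfl⟩ h
    refine absurd ?_ (GlobSpace.state_zero_ne_one Z)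
    rw [ContinuousMap.comp_apply, ContinuousMap.comp_apply, ReparamCategory.map_one hφ,
      ReparamCategory.map_zero hψ] at h
    exact (GlobSpace.mk_zero w).symm.trans (h.symm.trans (GlobSpace.mk_one z))

/-- The globe of the disk of dimension `n`. -/
abbrev globDisk (P : ReparamCategory) (T : SpaceConvention) (n : ℕ) :
    MultipointedDSpace.{u} P T :=
  glob P T (Disk.{u} n) (GlobSpace.holds_disk T n)

/-- The globe of the boundary of the disk of dimension `n`. -/
abbrev globBoundary (P : ReparamCategory) (T : SpaceConvention) (n : ℕ) :
    MultipointedDSpace.{u} P T :=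
  glob P T (DiskBoundary.{u} n) (GlobSpace.holds_diskBoundary T n)

/-- The map of globes induced by the inclusion of the boundary of the disk in the disk. -/
def globIncl (P : ReparamCategory) (T : SpaceConvention) (n : ℕ) :
    globBoundary.{u} P T n ⟶ globDisk.{u} P T n where
  toMap := GlobSpace.map (diskIncl.{u} n)
  map_states := by
    rintro _ ⟨i, rfl⟩
    exact ⟨i, rfl⟩
  map_execPaths := by
    rintro _ ⟨z, φ, hφ, rfl⟩
    exact ⟨diskIncl n z, φ, hφ, rfl⟩

/-! ### Cellular multipointed d-spaces and carriers -/

/-- A presentation of `X` as a cellular multipointed d-space. Here `J` is a nonempty well-ordered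
set (a nonzero ordinal `λ`), and `X` is the colimit of a colimit-preserving tower `F : J ⥤ _`
starting from a set `E`, in which every step from `j` to its successor is the attachment of one
globular cell along a map from the globe of a sphere. (If `J` has a greatest element `m`, then `X`
is isomorphic to `F.obj m`.) -/
structure CellularPresentation (X : MultipointedDSpace.{u} P T) (J : Type u) [LinearOrder J]
    [OrderBot J] [SuccOrder J] [WellFoundedLT J] where
  E : Type u
  ι : ofSet P T E ⟶ X
  tower : TransfiniteCompositionOfShape J ι
  /-- the integer `n_j`; the globular cell `c_j` has dimension `n_j + 1` -/
  dim : {j : J // ¬ IsMax j} → ℕ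
  attach (j : {j : J // ¬ IsMax j}) : globBoundary P T (dim j) ⟶ tower.F.obj j.1
  cellMap (j : {j : J // ¬ IsMax j}) : globDisk P T (dim j) ⟶ tower.F.obj (Order.succ j.1)
  isPushout (j : {j : J // ¬ IsMax j}) :
    IsPushout (attach j) (globIncl P T (dim j))
      (tower.F.map (homOfLE (Order.le_succ j.1))) (cellMap j)

namespace CellularPresentation

variable {X : MultipointedDSpace.{u} P T} {J : Type u} [LinearOrder J] [OrderBot J] [SuccOrder J]
  [WellFoundedLT J]

/-- The index set of the globular cells `c_j` of positive dimension. -/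
abbrev Cell (_C : CellularPresentation X J) : Type u := {j : J // ¬ IsMax j}

/-- The characteristic map `ĝ_j` from the globe of the disk to `X`. -/
def charMap (C : CellularPresentation X J) (j : C.Cell) : globDisk P T (C.dim j) ⟶ X :=
  C.cellMap j ≫ C.tower.incl.app (Order.succ j.1)

/-- `C.IsCarrier γ [c_1, …, c_n]`: the path `γ` is a Moore composition
`(ĝ_{c_1} δ_{z_1} φ_1 μ_{ℓ_1}) * ⋯ * (ĝ_{c_n} δ_{z_n} φ_n μ_{ℓ_n})` with `n ≥ 1`,
`z_i` in the interior of the disk, `φ_i ∈ 𝒫(1,1)`, `ℓ_i > 0`, `ℓ_1 + ⋯ + ℓ_n = 1`, where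
`μ_ℓ t = t / ℓ`. -/
def IsCarrier (C : CellularPresentation X J) (γ : C(unitInterval, X.carrier))
    (c : List C.Cell) : Prop :=
  c ≠ [] ∧ ∃ (z : ∀ i : Fin c.length, Disk.{u} (C.dim (c.get i)))
    (φ : Fin c.length → C(unitInterval, unitInterval)) (ℓ : Fin c.length → ℝ),
    (∀ i, ‖(z i).down.1‖ < 1) ∧ (∀ i, φ i ∈ P.maps) ∧ (∀ i, 0 < ℓ i) ∧ ∑ i, ℓ i = 1 ∧
    ∀ (i : Fin c.length) (s t : unitInterval),
      (t : ℝ) = ∑ j ∈ Finset.univ.filter (· < i), ℓ j + ℓ i * s →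
        γ t = (C.charMap (c.get i)).toMap (GlobSpace.delta (z i) (φ i s))

end CellularPresentation

end MultipointedDSpace

section TransfiniteExtension

open Opposite

universe w v

variable {D : Type u} [Category.{v} D] {J : Type w} [LinearOrder J] [OrderBot J] [SuccOrder J]
  [WellFoundedLT J]

/-- The projective system of the maps `F.obj j ⟶ Y` satisfying a property stable under
restriction. -/
def goodMaps (F : J ⥤ D) (Y : D) (Good : ∀ j, (F.obj j ⟶ Y) → Prop)
    (restrict : ∀ (i j : J) (hij : i ≤ j) (f : F.obj j ⟶ Y), Good j f →
      Good i (F.map (homOfLE hij) ≫ f)) : Jᵒᵖ ⥤ Type v where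
  obj j := {f : F.obj j.unop ⟶ Y // Good j.unop f}
  map {j i} a := ↾fun f => ⟨F.map a.unop ≫ f.1, restrict i.unop j.unop (leOfHom a.unop) f.1 f.2⟩
  map_id j := by ext f; simp
  map_comp a b := by ext f; simp

/-- Construction by transfinite induction of a map out of a transfinite composition: a map defined
on the first stage extends to the colimit as soon as extensions, within a class `Good` of maps,
exist at successor stages. -/
theorem CategoryTheory.TransfiniteCompositionOfShape.exists_hom_of_good {A X : D} {ι : A ⟶ X}
    (c : TransfiniteCompositionOfShape J ι) (Y : D) (Good : ∀ j, (c.F.obj j ⟶ Y) → Prop)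
    (restrict : ∀ (i j : J) (hij : i ≤ j) (f : c.F.obj j ⟶ Y), Good j f →
      Good i (c.F.map (homOfLE hij) ≫ f))
    (succ : ∀ (j : J), ¬ IsMax j → ∀ f : c.F.obj j ⟶ Y, Good j f →
      ∃ f', Good (Order.succ j) f' ∧ c.F.map (homOfLE (Order.le_succ j)) ≫ f' = f)
    (limit : ∀ j : J, Order.IsSuccLimit j → ∀ f : c.F.obj j ⟶ Y,
      (∀ (i : J) (hi : i < j), Good i (c.F.map (homOfLE hi.le) ≫ f)) → Good j f)
    (f₀ : c.F.obj ⊥ ⟶ Y) (h₀ : Good ⊥ f₀) :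
    ∃ f : X ⟶ Y, ∀ j, Good j (c.incl.app j ≫ f) := by
  let G := goodMaps c.F Y Good restrict
  have h1 : ∀ (j : J) (_ : ¬IsMax j),
      Function.Surjective (G.map (homOfLE (Order.le_succ j)).op) := by
    intro j hj f
    obtain ⟨f', hf', h⟩ := succ j hj f.1 f.2
    exact ⟨⟨f', hf'⟩, Subtype.ext h⟩
  have h2 : ∀ (j : J) (_ : Order.IsSuccLimit j)
      (x : ((OrderHom.Subtype.val (· ∈ Set.Iio j)).monotone.functor.op ⋙ G).sections),
      ∃ (y : G.obj (op j)), ∀ (i : J) (hi : i < j),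
        G.map (homOfLE hi.le).op y = x.val (op ⟨i, hi⟩) := by
    intro j hj x
    let hc := c.F.isColimitOfIsWellOrderContinuous j hj
    let s : Cocone ((Set.principalSegIio j).monotone.functor ⋙ c.F) :=
      { pt := Y
        ι :=
        { app := fun i => (x.1 ⟨i⟩).1
          naturality := fun i i' g => by
            have := congr_arg Subtype.val (x.2 g.op)
            exact this.trans (Category.comp_id _).symm } }
    have hfac : ∀ (i : J) (hi : i < j), c.F.map (homOfLE hi.le) ≫ hc.desc s =
        (x.1 (op ⟨i, hi⟩)).1 := fun i hi => hc.fac s ⟨i, hi⟩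
    refine ⟨⟨hc.desc s, limit j hj _ fun i hi => ?_⟩, fun i hi => Subtype.ext (hfac i hi)⟩
    rw [hfac]
    exact (x.1 (op ⟨i, hi⟩)).2
  obtain ⟨x, -⟩ := (Functor.WellOrderInductionData.ofExists h1 h2).surjective ⟨f₀, h₀⟩
  let s : Cocone c.F :=
    { pt := Y
      ι :=
      { app := fun i => (x.1 ⟨i⟩).1
        naturality := fun i i' g => by
          have := congr_arg Subtype.val (x.2 g.op)
          exact this.trans (Category.comp_id _).symm } }
  refine ⟨c.isColimit.desc s, fun j => ?_⟩
  have : c.incl.app j ≫ c.isColimit.desc s = (x.1 (op j)).1 := c.isColimit.fac s j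
  rw [this]
  exact (x.1 (op j)).2

end TransfiniteExtension

namespace GlobSpace

theorem map_mk {Z W : Type u} [TopologicalSpace Z] [TopologicalSpace W] (f : C(Z, W)) (z : Z)
    (t : unitInterval) : map f (mk z t) = mk (f z) t := rfl

@[elab_as_elim]
theorem ind {Z : Type u} [TopologicalSpace Z] {p : GlobSpace Z → Prop}
    (h_state : ∀ i, p (state Z i)) (h_mk : ∀ z t, p (mk z t)) (x : GlobSpace Z) : p x := by
  obtain ⟨i | ⟨z, t⟩⟩ := x
  exacts [h_state i, h_mk z t]

/-- A real function on `Z × [0,1]` vanishing on `Z × {0,1}` induces a function on the globe. -/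
def liftReal {Z : Type u} [TopologicalSpace Z] (w : C(Z × unitInterval, ℝ))
    (h0 : ∀ z, w (z, 0) = 0) (h1 : ∀ z, w (z, 1) = 0) : C(GlobSpace Z, ℝ) where
  toFun := Quot.lift (Sum.elim (fun _ => 0) w) (by
    rintro _ _ (z | z)
    exacts [h0 z, h1 z])
  continuous_toFun := continuous_quot_lift _ (Continuous.sumElim continuous_const w.continuous)

instance (n : ℕ) : T2Space (GlobSpace (Disk.{u} n)) :=
  t2Space (E := EuclideanSpace ℝ (Fin n)) ⟨fun z => z.down.1, by fun_prop⟩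
    (Subtype.val_injective.comp ULift.down_injective)

instance (n : ℕ) : CompactSpace (Disk.{u} n) :=
  Homeomorph.ulift.symm.compactSpace

instance (n : ℕ) : CompactSpace (DiskBoundary.{u} n) :=
  Homeomorph.ulift.symm.compactSpace

instance (Z : Type u) [TopologicalSpace Z] [CompactSpace Z] : CompactSpace (GlobSpace Z) :=
  inferInstanceAs (CompactSpace (Quot _))

open Classical in
theorem injective_map_diskIncl (n : ℕ) : Function.Injective (map (diskIncl.{u} n)) := by
  let r : GlobSpace (Disk.{u} n) → GlobSpace (DiskBoundary.{u} n) :=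
    Quot.lift (Sum.elim (state _) fun q =>
      if h : q.1.down.1 ∈ Metric.sphere (0 : EuclideanSpace ℝ (Fin n)) 1 then
        mk ⟨⟨q.1.down.1, h⟩⟩ q.2
      else if q.2 = 0 then state _ 0 else state _ 1) (by
        rintro _ _ (z | z)
        · dsimp only [Sum.elim_inr, Sum.elim_inl]
          split_ifs
          exacts [mk_zero _, rfl, absurd rfl ‹¬(0 : unitInterval) = 0›]
        · dsimp only [Sum.elim_inr, Sum.elim_inl]
          split_ifs
          exacts [mk_one _, absurd ‹(1 : unitInterval) = 0› one_ne_zero, rfl])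
  refine Function.LeftInverse.injective (g := r) fun x => ?_
  induction x using ind with
  | h_state i => rfl
  | h_mk z t => exact dif_pos z.down.2

theorem isClosedEmbedding_map_diskIncl (n : ℕ) : IsClosedEmbedding (map (diskIncl.{u} n)) :=
  (map (diskIncl.{u} n)).continuous.isClosedEmbedding (injective_map_diskIncl n)

/-- Real functions extend from the globe of the sphere to the globe of the disk. -/
theorem exists_extension (n : ℕ) (u : C(GlobSpace (DiskBoundary.{u} n), ℝ)) :
    ∃ v : C(GlobSpace (Disk.{u} n), ℝ), v.comp (map (diskIncl n)) = u :=
  ContinuousMap.exists_extension (isClosedEmbedding_map_diskIncl n) u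

/-- A function on the globe of the disk which is positive exactly on the open cell. -/
noncomputable def bump (n : ℕ) : C(GlobSpace (Disk.{u} n), ℝ) :=
  liftReal ⟨fun q => (1 - ‖q.1.down.1‖) * (q.2 * (1 - q.2)), by fun_prop⟩ (by simp) (by simp)

theorem bump_mk (n : ℕ) (z : Disk.{u} n) (t : unitInterval) :
    bump n (mk z t) = (1 - ‖z.down.1‖) * (t * (1 - t)) := rfl

theorem bump_state (n : ℕ) (i : Fin 2) : bump.{u} n (state _ i) = 0 := rfl

theorem bump_mk_pos {n : ℕ} {z : Disk.{u} n} {t : unitInterval} (hz : ‖z.down.1‖ < 1) (h0 : t ≠ 0)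
    (h1 : t ≠ 1) : 0 < bump n (mk z t) := by
  have a : 0 < (t : ℝ) := unitInterval.pos_iff_ne_zero.2 h0
  have b : (t : ℝ) < 1 := unitInterval.lt_one_iff_ne_one.2 h1
  rw [bump_mk]
  exact mul_pos (by linarith) (mul_pos a (by linarith))

theorem bump_map_diskIncl (n : ℕ) (x : GlobSpace (DiskBoundary.{u} n)) :
    bump n (map (diskIncl n) x) = 0 := by
  induction x using ind with
  | h_state i => rfl
  | h_mk z t =>
    have : ‖z.down.1‖ = 1 := mem_sphere_zero_iff_norm.1 z.down.2
    rw [map_mk, bump_mk]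
    change (1 - ‖z.down.1‖) * _ = 0
    rw [this, sub_self, zero_mul]

/-- Real functions on the globe of the sphere vanishing at the states and reaching `1` on all paths
extend to functions on the globe of the disk with the same property. -/
theorem exists_extension_reaching (n : ℕ) (u : C(GlobSpace (DiskBoundary.{u} n), ℝ))
    (hs : ∀ i, u (state _ i) = 0) (h1 : ∀ z, ∃ t, 1 ≤ u (mk z t)) :
    ∃ v : C(GlobSpace (Disk.{u} n), ℝ), v.comp (map (diskIncl n)) = u ∧
      ∀ z, ∃ t, 1 ≤ v (mk z t) := by
  obtain ⟨v₀, hv₀⟩ := exists_extension n u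
  have hv₀' : ∀ x, v₀ (map (diskIncl n) x) = u x := fun x => DFunLike.congr_fun hv₀ x
  let w : C(Disk.{u} n × unitInterval, ℝ) :=
    ⟨fun q => v₀ (mk q.1 q.2), v₀.continuous.comp continuous_mk⟩
  let wpos : C(Disk.{u} n × unitInterval, ℝ) :=
    ⟨fun q => max (v₀ (mk q.1 q.2)) 0, (v₀.continuous.comp continuous_mk).max continuous_const⟩
  let m : Disk.{u} n → ℝ := fun z => ‖wpos.curry z‖
  have hm : Continuous m := wpos.curry.continuous.norm
  have hle : ∀ z t, v₀ (mk z t) ≤ m z := fun z t =>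
    (le_max_left _ 0).trans ((le_abs_self _).trans ((wpos.curry z).norm_coe_le_norm t))
  have hatt : ∀ z, 0 < m z → ∃ t, v₀ (mk z t) = m z := by
    intro z hz
    obtain ⟨t, -, ht⟩ := isCompact_univ.exists_isMaxOn (Set.univ_nonempty (α := unitInterval))
      (wpos.curry z).continuous.continuousOn
    have hnn : ∀ s, 0 ≤ wpos.curry z s := fun s => le_max_right _ _
    have h : m z = wpos.curry z t := by
      refine le_antisymm ?_ ((le_abs_self _).trans ((wpos.curry z).norm_coe_le_norm t))
      refine (ContinuousMap.norm_le _ (hnn t)).2 fun s => ?_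
      rw [Real.norm_of_nonneg (hnn s)]
      exact ht (Set.mem_univ s)
    refine ⟨t, ?_⟩
    have h' : m z = max (v₀ (mk z t)) 0 := h
    rcases le_total (v₀ (mk z t)) 0 with h0 | h0
    · rw [max_eq_right h0] at h'
      exact absurd h' hz.ne'
    · rw [max_eq_left h0] at h'
      exact h'.symm
  let d : Disk.{u} n → ℝ := fun z => min 1 (max (m z) (1 / 2))
  have hd : Continuous d := continuous_const.min (hm.max continuous_const)
  have hdpos : ∀ z, 0 < d z := fun z =>
    lt_min one_pos (lt_of_lt_of_le (by norm_num) (le_max_right _ _))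
  let κ : Disk.{u} n → ℝ := fun z => max 0 (min 1 (2 * (1 - m z)))
  have hκ : Continuous κ := by fun_prop
  let W : Disk.{u} n × unitInterval → ℝ := fun q =>
    w q / d q.1 + κ q.1 * max 0 (4 * (q.2 * (1 - q.2)) - w q / d q.1)
  have hW : Continuous W := by
    have h1 : Continuous fun q : Disk.{u} n × unitInterval => w q / d q.1 :=
      w.continuous.div (hd.comp continuous_fst) fun q => (hdpos q.1).ne'
    have h2 : Continuous fun q : Disk.{u} n × unitInterval => κ q.1 := hκ.comp continuous_fst
    have h3 : Continuous fun q : Disk.{u} n × unitInterval => (4 * (q.2 * (1 - q.2)) : ℝ) := by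
      fun_prop
    exact h1.add (h2.mul (continuous_const.max (h3.sub h1)))
  have hv₀s : ∀ i, v₀ (state _ i) = 0 := fun i => (hv₀' (state _ i)).trans (hs i)
  have hw0 : ∀ z, w (z, 0) = 0 := fun z => by
    change v₀ (mk z 0) = 0
    rw [mk_zero, hv₀s]
  have hw1 : ∀ z, w (z, 1) = 0 := fun z => by
    change v₀ (mk z 1) = 0
    rw [mk_one, hv₀s]
  refine ⟨liftReal ⟨W, hW⟩ (fun z => ?_) fun z => ?_, ?_, fun z => ?_⟩
  · simp [W, hw0]
  · simp [W, hw1]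
  · ext x
    induction x using ind with
    | h_state i => exact (hs i).symm
    | h_mk z t =>
      change W (diskIncl n z, t) = u (mk z t)
      have hwz : ∀ s, w (diskIncl n z, s) = u (mk z s) := fun s => hv₀' (mk z s)
      obtain ⟨s, hs⟩ := h1 z
      have hm1 : 1 ≤ m (diskIncl n z) := hs.trans ((hwz s).symm.le.trans (hle _ s))
      have hd1 : d (diskIncl n z) = 1 := min_eq_left (hm1.trans (le_max_left _ _))
      have hκ0 : κ (diskIncl n z) = 0 :=
        max_eq_left ((min_le_right _ _).trans (by linarith))
      simp [W, hd1, hκ0, hwz]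
  · change ∃ t, 1 ≤ W (z, t)
    rcases le_or_gt (1 / 2) (m z) with h | h
    · obtain ⟨t, ht⟩ := hatt z (lt_of_lt_of_le (by norm_num) h)
      refine ⟨t, ?_⟩
      have hwt : w (z, t) = m z := ht
      have : 1 ≤ w (z, t) / d z := by
        rw [hwt, one_le_div (hdpos z)]
        exact (min_le_right _ _).trans (max_le le_rfl h)
      have h' : 0 ≤ κ z * max 0 (4 * ((t : ℝ) * (1 - t)) - w (z, t) / d z) :=
        mul_nonneg (le_max_left _ _) (le_max_left _ _)
      change 1 ≤ w (z, t) / d z + κ z * max 0 (4 * ((t : ℝ) * (1 - t)) - w (z, t) / d z)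
      linarith
    · have hκ1 : κ z = 1 := by
        have : min 1 (2 * (1 - m z)) = 1 := min_eq_left (by linarith)
        simp [κ, this]
      refine ⟨⟨1 / 2, by norm_num, by norm_num⟩, ?_⟩
      simp only [W, hκ1, one_mul]
      have := le_max_right 0 (4 * ((1 / 2 : ℝ) * (1 - 1 / 2)) -
        w (z, ⟨1 / 2, by norm_num, by norm_num⟩) / d z)
      linarith

end GlobSpace

theorem ReparamCategory.id_mem (P : ReparamCategory) : ContinuousMap.id unitInterval ∈ P.maps := by
  cases P with
  | G => exact ⟨monotone_id, IsHomeomorph.id⟩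
  | M => exact ⟨monotone_id, Function.surjective_id⟩

theorem map_homOfLE_self {D : Type*} [Category* D] {J : Type*} [Preorder J] (F : J ⥤ D) {j : J}
    (h : j ≤ j) {Y : D} (f : F.obj j ⟶ Y) : F.map (homOfLE h) ≫ f = f :=
  (congrArg (· ≫ f) (F.map_id j)).trans (Category.id_comp f)

theorem map_homOfLE_comp {D : Type*} [Category* D] {J : Type*} [Preorder J] (F : J ⥤ D)
    {i j k : J} (h : i ≤ j) (h' : j ≤ k) {Y : D} (f : F.obj k ⟶ Y) :
    F.map (homOfLE h) ≫ F.map (homOfLE h') ≫ f = F.map (homOfLE (h.trans h')) ≫ f := by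
  rw [← F.map_comp_assoc]
  rfl

namespace MultipointedDSpace

variable {P : ReparamCategory} {T : SpaceConvention}

theorem hom_ext {X Y : MultipointedDSpace.{u} P T} {f g : X ⟶ Y}
    (h : ∀ x, f.toMap x = g.toMap x) : f = g :=
  Hom.ext (ContinuousMap.ext h)

/-- The real line with `0` as unique state, the execution paths being the loops at `0` reaching the
threshold `c`. -/
def realLoops (P : ReparamCategory) (T : SpaceConvention) (c : ℝ) :
    MultipointedDSpace.{u} P T where
  carrier := ULift.{u} ℝ
  holds := T.holds_of_t2 _ (deltaGeneratedSpace_of_local_retract (E := ℝ) fun _ =>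
    ⟨⟨ULift.up, continuous_uliftUp⟩, ULift.down, continuous_uliftDown.continuousAt,
      Eventually.of_forall fun _ => rfl⟩)
  states := {⟨0⟩}
  execPaths := {γ | γ 0 = ⟨0⟩ ∧ γ 1 = ⟨0⟩ ∧ ∃ t, c ≤ (γ t).down}
  source_mem γ h := h.1
  target_mem γ h := h.2.1
  reparam_mem := by
    rintro γ ⟨h0, h1, t, ht⟩ φ hφ
    obtain ⟨s, rfl⟩ := (ReparamCategory.monotone_surjective hφ).2 t
    refine ⟨?_, ?_, s, ht⟩
    · rw [ContinuousMap.comp_apply, ReparamCategory.map_zero hφ, h0]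
    · rw [ContinuousMap.comp_apply, ReparamCategory.map_one hφ, h1]
  comp_mem := by
    rintro γ₁ ⟨h0, h1, t, ht⟩ γ₂ ⟨h0', h1', -⟩ h
    refine ⟨(Path.source _).trans h0, (Path.target _).trans h1',
      ⟨t / 2, by linarith [t.2.1], by linarith [t.2.2]⟩, ?_⟩
    have : normalizedComp γ₁ γ₂ h ⟨t / 2, by linarith [t.2.1], by linarith [t.2.2]⟩ = γ₁ t := by
      refine (Path.trans_apply _ _ _).trans ?_
      rw [dif_pos (by change (t : ℝ) / 2 ≤ 1 / 2; linarith [t.2.2])]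
      change γ₁ _ = γ₁ t
      congr 1
      exact Subtype.ext (by change 2 * ((t : ℝ) / 2) = t; ring)
    rw [this]
    exact ht

/-- The real function underlying a map to `realLoops`. -/
def Hom.real {c : ℝ} {X : MultipointedDSpace.{u} P T} (f : Hom X (realLoops P T c)) :
    C(X.carrier, ℝ) where
  toFun x := (f.toMap x).down
  continuous_toFun := continuous_uliftDown.comp f.toMap.continuous

theorem Hom.real_state {c : ℝ} {X : MultipointedDSpace.{u} P T} (f : Hom X (realLoops P T c))
    {x : X.carrier} (hx : x ∈ X.states) : f.real x = 0 :=
  congrArg ULift.down (f.map_states x hx)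

theorem Hom.exists_le_real {c : ℝ} {X : MultipointedDSpace.{u} P T} (f : Hom X (realLoops P T c))
    {γ : C(unitInterval, X.carrier)} (hγ : γ ∈ X.execPaths) : ∃ t, c ≤ f.real (γ t) :=
  (f.map_execPaths γ hγ).2.2

theorem delta_mem_execPaths {Z : Type u} [TopologicalSpace Z] (hZ : T.Holds (GlobSpace Z)) (z : Z) :
    GlobSpace.delta z ∈ (glob P T Z hZ).execPaths :=
  ⟨z, _, P.id_mem, rfl⟩

/-- Maps from a globe to `realLoops`. -/
def globToReal {c : ℝ} {Z : Type u} [TopologicalSpace Z] (hZ : T.Holds (GlobSpace Z))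
    (g : C(GlobSpace Z, ℝ)) (hs : ∀ i, g (GlobSpace.state Z i) = 0)
    (hc : ∀ z, ∃ t, c ≤ g (GlobSpace.mk z t)) : glob P T Z hZ ⟶ realLoops P T c where
  toMap := ⟨fun x => ⟨g x⟩, continuous_uliftUp.comp g.continuous⟩
  map_states := by
    rintro _ ⟨i, rfl⟩
    exact congrArg ULift.up (hs i)
  map_execPaths := by
    rintro _ ⟨z, φ, hφ, rfl⟩
    refine (realLoops P T c).reparam_mem
      ((⟨fun x => ⟨g x⟩, continuous_uliftUp.comp g.continuous⟩ : C(_, ULift ℝ)).comp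
        (GlobSpace.delta z)) ⟨?_, ?_, hc z⟩ φ hφ
    · exact congrArg ULift.up ((congrArg g (GlobSpace.mk_zero z)).trans (hs 0))
    · exact congrArg ULift.up ((congrArg g (GlobSpace.mk_one z)).trans (hs 1))

/-- The constant map to `realLoops` with threshold `0`. -/
def zeroHom (X : MultipointedDSpace.{u} P T) : X ⟶ realLoops P T 0 where
  toMap := ContinuousMap.const _ ⟨0⟩
  map_states _ _ := rfl
  map_execPaths _ _ := ⟨rfl, rfl, 0, le_rfl⟩

theorem exists_globDisk_extension_reaching (n : ℕ) (u : globBoundary P T n ⟶ realLoops P T 1) :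
    ∃ v : globDisk.{u} P T n ⟶ realLoops P T 1, globIncl P T n ≫ v = u := by
  obtain ⟨v, hv, hv1⟩ := GlobSpace.exists_extension_reaching n (Hom.real u)
    (fun i => Hom.real_state u ⟨i, rfl⟩) fun z => Hom.exists_le_real u (delta_mem_execPaths _ z)
  have hv' : ∀ x, v (GlobSpace.map (diskIncl n) x) = Hom.real u x := fun x =>
    DFunLike.congr_fun hv x
  refine ⟨globToReal _ v (fun i => ?_) hv1, hom_ext fun x => congrArg ULift.up (hv' x)⟩
  exact (hv' (GlobSpace.state _ i)).trans (Hom.real_state u ⟨i, rfl⟩)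

theorem exists_globDisk_extension_value (n : ℕ) (u : globBoundary P T n ⟶ realLoops P T 0)
    (z : Disk.{u} n) (hz : ‖z.down.1‖ < 1) (t : unitInterval) (h0 : t ≠ 0) (h1 : t ≠ 1) (a : ℝ) :
    ∃ v : globDisk.{u} P T n ⟶ realLoops P T 0, globIncl P T n ≫ v = u ∧
      Hom.real v (GlobSpace.mk z t) = a := by
  obtain ⟨v, hv⟩ := GlobSpace.exists_extension n (Hom.real u)
  have hv' : ∀ x, v (GlobSpace.map (diskIncl n) x) = Hom.real u x := fun x =>
    DFunLike.congr_fun hv x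
  have hpos := GlobSpace.bump_mk_pos hz h0 h1
  let b : ℝ := (a - v (GlobSpace.mk z t)) / GlobSpace.bump n (GlobSpace.mk z t)
  have hs : ∀ i, (v + b • GlobSpace.bump n) (GlobSpace.state _ i) = 0 := fun i => by
    have : v (GlobSpace.state _ i) = 0 :=
      (hv' (GlobSpace.state _ i)).trans (Hom.real_state u ⟨i, rfl⟩)
    simp [this, GlobSpace.bump_state]
  refine ⟨globToReal _ (v + b • GlobSpace.bump n) hs fun w => ⟨0, ?_⟩, hom_ext
    fun (x : GlobSpace _) => ?_, ?_⟩
  · rw [GlobSpace.mk_zero, hs]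
  · refine congrArg ULift.up ?_
    change v (GlobSpace.map (diskIncl n) x) + b * GlobSpace.bump n (GlobSpace.map (diskIncl n) x) =
      Hom.real u x
    rw [hv', GlobSpace.bump_map_diskIncl, mul_zero, add_zero]
  · change v (GlobSpace.mk z t) + b * GlobSpace.bump n (GlobSpace.mk z t) = a
    rw [div_mul_cancel₀ _ hpos.ne']
    ring

/-- The map from the globe of the disk to `realLoops` which vanishes exactly outside the open
cell. -/
noncomputable def bumpHom (n : ℕ) : globDisk.{u} P T n ⟶ realLoops P T 0 :=
  globToReal _ (GlobSpace.bump n) (GlobSpace.bump_state n) fun z =>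
    ⟨0, by rw [GlobSpace.mk_zero, GlobSpace.bump_state]⟩

theorem globIncl_bumpHom (n : ℕ) :
    globIncl.{u} P T n ≫ bumpHom n = zeroHom (globBoundary.{u} P T n) :=
  hom_ext fun x => congrArg ULift.up (GlobSpace.bump_map_diskIncl n x)

namespace CellularPresentation

variable {X : MultipointedDSpace.{u} P T} {J : Type u} [LinearOrder J] [OrderBot J] [SuccOrder J]
  [WellFoundedLT J]

/-- A map defined on a stage `k` of the tower extends to `X`, with prescribed properties on the
subsequent cells, as soon as it can be extended cell by cell. -/
theorem exists_hom_extension (C : CellularPresentation X J) (Y : MultipointedDSpace.{u} P T)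
    (R : ∀ i : C.Cell, (globDisk P T (C.dim i) ⟶ Y) → Prop)
    (hR : ∀ (i : C.Cell) (u : globBoundary P T (C.dim i) ⟶ Y),
      ∃ v, globIncl P T (C.dim i) ≫ v = u ∧ R i v)
    (k : J) (f₀ : C.tower.F.obj k ⟶ Y) :
    ∃ f : X ⟶ Y, C.tower.incl.app k ≫ f = f₀ ∧ ∀ i : C.Cell, k ≤ i.1 → R i (C.charMap i ≫ f) := by
  let F := C.tower.F
  let Good : ∀ j, (F.obj j ⟶ Y) → Prop := fun j f =>
    (∀ h : j ≤ k, f = F.map (homOfLE h) ≫ f₀) ∧ (∀ h : k ≤ j, F.map (homOfLE h) ≫ f = f₀) ∧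
    ∀ (i : C.Cell) (_ : k ≤ i.1) (h : Order.succ i.1 ≤ j),
      R i (C.cellMap i ≫ F.map (homOfLE h) ≫ f)
  suffices h : ∃ f : X ⟶ Y, ∀ j, Good j (C.tower.incl.app j ≫ f) by
    obtain ⟨f, hf⟩ := h
    refine ⟨f, (hf k).2.1 le_rfl |>.symm.trans ?_ |>.symm, fun i hi => ?_⟩
    · rw [map_homOfLE_self]
    · have := (hf (Order.succ i.1)).2.2 i hi le_rfl
      rw [map_homOfLE_self] at this
      rwa [charMap, Category.assoc]
  refine C.tower.exists_hom_of_good Y Good ?_ ?_ ?_ (F.map (homOfLE bot_le) ≫ f₀) ?_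
  · rintro i j hij f ⟨h1, h2, h3⟩
    refine ⟨fun h => ?_, fun h => ?_, fun i' hi' h => ?_⟩
    · rcases le_total j k with hj | hj
      · rw [h1 hj, map_homOfLE_comp]
      · rw [← h2 hj, map_homOfLE_comp]
    · rw [map_homOfLE_comp, h2]
    · rw [map_homOfLE_comp]
      exact h3 i' hi' _
  · rintro j hj f ⟨h1, h2, h3⟩
    rcases lt_or_ge j k with hjk | hjk
    · have hs : Order.succ j ≤ k := Order.succ_le_of_lt hjk
      refine ⟨F.map (homOfLE hs) ≫ f₀, ⟨fun _ => rfl, fun h => ?_, fun i hi h => ?_⟩, ?_⟩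
      · rw [map_homOfLE_comp, map_homOfLE_self]
      · exact absurd (lt_of_lt_of_le (Order.lt_succ_of_not_isMax i.2) (h.trans (hs.trans hi)))
          (lt_irrefl _)
      · rw [h1 hjk.le, map_homOfLE_comp]
    · obtain ⟨v, hv, hRv⟩ := hR ⟨j, hj⟩ (C.attach ⟨j, hj⟩ ≫ f)
      have po := C.isPushout ⟨j, hj⟩
      have hl : F.map (homOfLE (Order.le_succ j)) ≫ po.desc f v hv.symm = f := po.inl_desc _ _ _
      have hr : C.cellMap ⟨j, hj⟩ ≫ po.desc f v hv.symm = v := po.inr_desc _ _ _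
      refine ⟨po.desc f v hv.symm, ⟨fun h => ?_, fun h => ?_, fun i hi h => ?_⟩, hl⟩
      · exact absurd (lt_of_lt_of_le (Order.lt_succ_of_not_isMax hj) (h.trans hjk)) (lt_irrefl _)
      · rw [← homOfLE_comp hjk (Order.le_succ j), F.map_comp, Category.assoc, hl, h2]
      · rcases eq_or_lt_of_le ((Order.succ_le_succ_iff_of_not_isMax i.2 hj).1 h) with h' | h'
        · obtain rfl : i = ⟨j, hj⟩ := Subtype.ext h'
          rwa [map_homOfLE_self, hr]
        · have hi' := Order.succ_le_of_lt h'
          rw [← homOfLE_comp hi' (Order.le_succ j), F.map_comp, Category.assoc, hl]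
          exact h3 i hi hi'
  · rintro j hj f h
    refine ⟨fun hjk => ?_, fun hkj => ?_, fun i hi hij => ?_⟩
    · refine (F.isColimitOfIsWellOrderContinuous j hj).hom_ext fun ⟨i, hi⟩ => ?_
      refine ((h i hi).1 (hi.le.trans hjk)).trans ?_
      change _ = F.map (homOfLE hi.le) ≫ F.map _ ≫ f₀
      rw [map_homOfLE_comp]
    · rcases eq_or_lt_of_le hkj with rfl | hkj'
      · rw [map_homOfLE_self]
        refine (F.isColimitOfIsWellOrderContinuous k hj).hom_ext fun ⟨i, hi⟩ => ?_
        exact (h i hi).1 hi.le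
      · have := (h k hkj').2.1 le_rfl
        rwa [map_homOfLE_self] at this
    · have hij' : Order.succ i.1 < j :=
        hj.isSuccPrelimit.succ_lt (lt_of_lt_of_le (Order.lt_succ_of_not_isMax i.2) hij)
      have := (h _ hij').2.2 i hi le_rfl
      rwa [map_homOfLE_self] at this
  · refine ⟨fun _ => rfl, fun h => ?_, fun i hi h => ?_⟩
    · rw [map_homOfLE_comp, map_homOfLE_self]
    · exact absurd (lt_of_lt_of_le (Order.lt_succ_of_not_isMax i.2) (h.trans bot_le)) not_lt_bot

/-- A map separating the cell `c_k` from the previous stages of the tower. -/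
theorem exists_hom_bump (C : CellularPresentation X J) (k : C.Cell) :
    ∃ f : X ⟶ realLoops P T 0, C.charMap k ≫ f = bumpHom (C.dim k) ∧
      C.tower.incl.app k.1 ≫ f = zeroHom (C.tower.F.obj k.1) := by
  have po := C.isPushout k
  have h : C.attach k ≫ zeroHom (C.tower.F.obj k.1) = globIncl P T (C.dim k) ≫ bumpHom _ :=
    (globIncl_bumpHom _).symm
  obtain ⟨f, hf, -⟩ := C.exists_hom_extension (realLoops P T 0) (fun _ _ => True)
    (fun i u => by
      obtain ⟨v, hv, -⟩ := exists_globDisk_extension_value (C.dim i) u ⟨⟨0, by simp⟩⟩ (by simp)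
        ⟨1 / 2, by norm_num, by norm_num⟩ (by simp [Subtype.ext_iff]) (by simp [Subtype.ext_iff]) 0
      exact ⟨v, hv, trivial⟩) (Order.succ k.1) (po.desc _ _ h)
  refine ⟨f, ?_, ?_⟩
  · rw [charMap, Category.assoc, hf, po.inr_desc]
  · have := C.tower.incl.naturality (homOfLE (Order.le_succ k.1))
    rw [← this.trans (Category.comp_id _), Category.assoc, hf, po.inl_desc]

/-- A map to any space with a state from the first stage of the tower. -/
def botHom (C : CellularPresentation X J) {Y : MultipointedDSpace.{u} P T} {y : Y.carrier}
    (hy : y ∈ Y.states) : C.tower.F.obj ⊥ ⟶ Y where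
  toMap := ContinuousMap.const _ y
  map_states _ _ := hy
  map_execPaths γ hγ := (C.tower.isoBot.hom.map_execPaths γ hγ).elim

/-- A function vanishing at the states and reaching `1` on each execution path. -/
theorem nonempty_hom_realLoops_one (C : CellularPresentation X J) :
    Nonempty (X ⟶ realLoops P T 1) := by
  obtain ⟨f, -⟩ := C.exists_hom_extension (realLoops P T 1) (fun _ _ => True)
    (fun i u => by
      obtain ⟨v, hv⟩ := exists_globDisk_extension_reaching (C.dim i) u
      exact ⟨v, hv, trivial⟩) ⊥ (C.botHom (y := ⟨0⟩) rfl)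
  exact ⟨f⟩

/-- A function with prescribed values at a point of each open cell. -/
theorem exists_hom_value (C : CellularPresentation X J) (z : ∀ i : C.Cell, Disk.{u} (C.dim i))
    (hz : ∀ i, ‖(z i).down.1‖ < 1) (t : unitInterval) (h0 : t ≠ 0) (h1 : t ≠ 1) (a : C.Cell → ℝ) :
    ∃ f : X ⟶ realLoops P T 0,
      ∀ i, Hom.real f ((C.charMap i).toMap (GlobSpace.mk (z i) t)) = a i := by
  obtain ⟨f, -, hf⟩ := C.exists_hom_extension (realLoops P T 0)
    (fun i v => Hom.real v (GlobSpace.mk (z i) t) = a i)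
    (fun i u => exists_globDisk_extension_value (C.dim i) u (z i) (hz i) t h0 h1 (a i)) ⊥
    (C.botHom (y := ⟨0⟩) rfl)
  exact ⟨f, fun i => hf i bot_le⟩

end CellularPresentation

end MultipointedDSpace

theorem ReparamCategory.mem_maps_iff {P : ReparamCategory} {φ : C(unitInterval, unitInterval)} :
    φ ∈ P.maps ↔ Monotone φ ∧ φ 0 = 0 ∧ φ 1 = 1 ∧ (P = .G → StrictMono φ) := by
  have surj : φ 0 = 0 → φ 1 = 1 → Function.Surjective φ := fun h0 h1 t =>
    mem_range_of_exists_le_of_exists_ge φ.continuous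
      ⟨0, h0.trans_le unitInterval.nonneg'⟩ ⟨1, unitInterval.le_one'.trans_eq h1.symm⟩
  constructor
  · intro h
    refine ⟨(monotone_surjective h).1, map_zero h, map_one h, ?_⟩
    rintro rfl
    exact h.1.strictMono_of_injective h.2.injective
  · rintro ⟨hm, h0, h1, hs⟩
    cases P with
    | G => exact ⟨hm, isHomeomorph_iff_continuous_bijective.2
        ⟨φ.continuous, (hs rfl).injective, surj h0 h1⟩⟩
    | M => exact ⟨hm, surj h0 h1⟩

theorem Fin.sum_filter_lt_succ {n : ℕ} (ℓ : Fin (n + 1) → ℝ) (i : Fin n) :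
    ∑ j ∈ Finset.univ.filter (· < i.succ), ℓ j =
      ℓ 0 + ∑ j ∈ Finset.univ.filter (· < i), ℓ j.succ := by
  rw [Finset.sum_filter, Finset.sum_filter, Fin.sum_univ_succ]
  simp

/-- `P.IncreasingOn ψ a b`: the real function `ψ` is continuous and nondecreasing on `[a,b]`, and
increasing if `P` is `𝒢`. -/
structure ReparamCategory.IncreasingOn (P : ReparamCategory) (ψ : ℝ → ℝ) (a b : ℝ) : Prop where
  continuousOn : ContinuousOn ψ (Set.Icc a b)
  monotoneOn : MonotoneOn ψ (Set.Icc a b)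
  strictMonoOn : P = .G → StrictMonoOn ψ (Set.Icc a b)

namespace ReparamCategory.IncreasingOn

variable {P : ReparamCategory} {ψ θ : ℝ → ℝ} {a b a' b' : ℝ}

theorem mapsTo (h : P.IncreasingOn θ a' b') (ha : θ a' = a) (hb : θ b' = b) :
    Set.MapsTo θ (Set.Icc a' b') (Set.Icc a b) := fun _ ht =>
  have hab := ht.1.trans ht.2
  ⟨ha ▸ h.monotoneOn (Set.left_mem_Icc.2 hab) ht ht.1,
    hb ▸ h.monotoneOn ht (Set.right_mem_Icc.2 hab) ht.2⟩

theorem comp (h : P.IncreasingOn ψ a b) (h' : P.IncreasingOn θ a' b') (ha : θ a' = a)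
    (hb : θ b' = b) : P.IncreasingOn (ψ ∘ θ) a' b' where
  continuousOn := h.continuousOn.comp h'.continuousOn (h'.mapsTo ha hb)
  monotoneOn := h.monotoneOn.comp h'.monotoneOn (h'.mapsTo ha hb)
  strictMonoOn hP := (h.strictMonoOn hP).comp (h'.strictMonoOn hP) (h'.mapsTo ha hb)

theorem mono (h : P.IncreasingOn ψ a b) (ha : a ≤ a') (hb : b' ≤ b) :
    P.IncreasingOn ψ a' b' where
  continuousOn := h.continuousOn.mono (Set.Icc_subset_Icc ha hb)
  monotoneOn := h.monotoneOn.mono (Set.Icc_subset_Icc ha hb)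
  strictMonoOn hP := (h.strictMonoOn hP).mono (Set.Icc_subset_Icc ha hb)

theorem affine {k : ℝ} (hk : 0 < k) (m a b : ℝ) : P.IncreasingOn (fun t => k * t + m) a b where
  continuousOn := by fun_prop
  monotoneOn := fun s _ t _ h => by
    change k * s + m ≤ k * t + m
    nlinarith
  strictMonoOn := fun _ s _ t _ h => by
    change k * s + m < k * t + m
    nlinarith

theorem of_mem_maps {φ : C(unitInterval, unitInterval)} (h : φ ∈ P.maps) :
    P.IncreasingOn (fun t => (φ (Set.projIcc 0 1 zero_le_one t) : ℝ)) 0 1 where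
  continuousOn := by fun_prop
  monotoneOn := fun s _ t _ hst =>
    (mem_maps_iff.1 h).1 (Set.monotone_projIcc _ hst)
  strictMonoOn := fun hP s hs t ht hst =>
    (mem_maps_iff.1 h).2.2.2 hP (Set.strictMonoOn_projIcc _ hs ht hst)

theorem exists_mem_maps (h : P.IncreasingOn ψ 0 1) (h0 : ψ 0 = 0) (h1 : ψ 1 = 1) :
    ∃ φ ∈ P.maps, ∀ t : unitInterval, (φ t : ℝ) = ψ t := by
  have hm := h.mapsTo h0 h1
  refine ⟨⟨fun t => ⟨ψ t, hm t.2⟩, ?_⟩, mem_maps_iff.2 ⟨?_, ?_, ?_, ?_⟩, fun t => rfl⟩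
  · exact (continuousOn_iff_continuous_domRestrict.1 h.continuousOn).subtype_mk _
  · exact fun s t hst => h.monotoneOn s.2 t.2 hst
  · exact Subtype.ext h0
  · exact Subtype.ext h1
  · exact fun hP s t hst => h.strictMonoOn hP s.2 t.2 hst

end ReparamCategory.IncreasingOn

namespace MultipointedDSpace.CellularPresentation

variable {P : ReparamCategory} {T : SpaceConvention}
  {X : MultipointedDSpace.{u} P T} {J : Type u} [LinearOrder J] [OrderBot J] [SuccOrder J]
  [WellFoundedLT J]

/-- On `[a,b]`, the map `Γ` runs once through the cell `c`. -/
def IsStep (C : CellularPresentation X J) (Γ : ℝ → X.carrier) (a b : ℝ) (c : C.Cell) : Prop :=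
  a < b ∧ ∃ z : Disk.{u} (C.dim c), ‖z.down.1‖ < 1 ∧ ∃ ψ : ℝ → ℝ, P.IncreasingOn ψ a b ∧
    ψ a = 0 ∧ ψ b = 1 ∧ ∀ t ∈ Set.Icc a b,
      Γ t = (C.charMap c).toMap (GlobSpace.mk z (Set.projIcc 0 1 zero_le_one (ψ t)))

/-- On `[a,b]`, the map `Γ` runs successively through the cells of a nonempty list. -/
inductive IsCarrierOn (C : CellularPresentation X J) (Γ : ℝ → X.carrier) :
    ℝ → ℝ → List C.Cell → Prop
  | single {a b : ℝ} {c : C.Cell} (h : C.IsStep Γ a b c) : IsCarrierOn C Γ a b [c]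
  | cons {a b d : ℝ} {c : C.Cell} {l : List C.Cell} (h : C.IsStep Γ a b c)
    (h' : IsCarrierOn C Γ b d l) : IsCarrierOn C Γ a d (c :: l)

variable {C : CellularPresentation X J} {Γ Γ' : ℝ → X.carrier} {a b d a' b' d' : ℝ} {c : C.Cell}
  {l l' : List C.Cell} {θ : ℝ → ℝ}

theorem IsStep.reparam (h : C.IsStep Γ a b c) (hab : a' < b')
    (hθ : P.IncreasingOn θ a' b') (ha : θ a' = a) (hb : θ b' = b)
    (hΓ : ∀ t ∈ Set.Icc a' b', Γ' t = Γ (θ t)) : C.IsStep Γ' a' b' c := by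
  obtain ⟨-, z, hz, ψ, hψ, h0, h1, h⟩ := h
  exact ⟨hab, z, hz, ψ ∘ θ, hψ.comp hθ ha hb, by simp [ha, h0], by simp [hb, h1],
    fun t ht => (hΓ t ht).trans (h _ (hθ.mapsTo ha hb ht))⟩

theorem IsCarrierOn.lt (h : C.IsCarrierOn Γ a b l) : a < b := by
  induction h with
  | single h => exact h.1
  | cons h _ ih => exact h.1.trans ih

theorem IsCarrierOn.ne_nil (h : C.IsCarrierOn Γ a b l) : l ≠ [] := by
  cases h <;> exact List.cons_ne_nil _ _

theorem IsCarrierOn.reparam (h : C.IsCarrierOn Γ a d l) (hle : a' ≤ d')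
    (hθ : P.IncreasingOn θ a' d') (ha : θ a' = a) (hd : θ d' = d)
    (hΓ : ∀ t ∈ Set.Icc a' d', Γ' t = Γ (θ t)) : C.IsCarrierOn Γ' a' d' l := by
  induction h generalizing a' with
  | single h =>
    refine .single (h.reparam (lt_of_le_of_ne hle ?_) hθ ha hd hΓ)
    rintro rfl
    exact h.1.ne (ha.symm.trans hd)
  | @cons a b d c l h h' ih =>
    obtain ⟨b', hb', rfl⟩ := intermediate_value_Icc hle hθ.continuousOn
      (show b ∈ _ by rw [ha, hd]; exact ⟨h.1.le, h'.lt.le⟩)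
    refine .cons (b := b') (h.reparam (lt_of_le_of_ne hb'.1 ?_) (hθ.mono le_rfl hb'.2) ha rfl
      fun t ht => hΓ t ⟨ht.1, ht.2.trans hb'.2⟩) (ih hb'.2 (hθ.mono hb'.1 le_rfl) rfl hd
        fun t ht => hΓ t ⟨hb'.1.trans ht.1, ht.2⟩)
    rintro rfl
    exact h.1.ne ha.symm

theorem IsCarrierOn.append (h : C.IsCarrierOn Γ a b l) (h' : C.IsCarrierOn Γ b d l') :
    C.IsCarrierOn Γ a d (l ++ l') := by
  induction h with
  | single h => exact .cons h h'
  | cons h _ ih => exact .cons h (ih h')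

theorem isStep_iff : C.IsStep Γ a b c ↔ a < b ∧ ∃ z : Disk.{u} (C.dim c), ‖z.down.1‖ < 1 ∧
    ∃ φ ∈ P.maps, ∀ s : unitInterval,
      Γ (a + (b - a) * s) = (C.charMap c).toMap (GlobSpace.delta z (φ s)) := by
  refine and_congr_right fun hab => exists_congr fun z => and_congr_right fun _ => ?_
  have hba : 0 < b - a := sub_pos.2 hab
  constructor
  · rintro ⟨ψ, hψ, h0, h1, h⟩
    have hθ := ReparamCategory.IncreasingOn.affine (P := P) hba a 0 1
    obtain ⟨φ, hφ, hφψ⟩ := (hψ.comp hθ (by ring) (by ring)).exists_mem_maps (by simpa using h0)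
      (by simpa using h1)
    refine ⟨φ, hφ, fun s => ?_⟩
    have e : a + (b - a) * s = (b - a) * s + a := add_comm _ _
    rw [e, h _ (hθ.mapsTo (by ring) (by ring) s.2)]
    have : Set.projIcc 0 1 zero_le_one (ψ ((b - a) * s + a)) = φ s := by
      have := hφψ s
      rw [Function.comp_apply] at this
      rw [← this, Set.projIcc_val]
    rw [this]
    rfl
  · rintro ⟨φ, hφ, h⟩
    have hθ := ReparamCategory.IncreasingOn.affine (P := P) (inv_pos.2 hba) (-((b - a)⁻¹ * a)) a b
    have ea : (b - a)⁻¹ * a + -((b - a)⁻¹ * a) = 0 := by ring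
    have eb : (b - a)⁻¹ * b + -((b - a)⁻¹ * a) = 1 := by
      rw [← sub_eq_add_neg, ← mul_sub, inv_mul_cancel₀ hba.ne']
    refine ⟨_, (ReparamCategory.IncreasingOn.of_mem_maps hφ).comp hθ ea eb, ?_, ?_, fun t ht => ?_⟩
    · simp [ea, ReparamCategory.map_zero hφ]
    · simp [eb, ReparamCategory.map_one hφ]
    · have hs := hθ.mapsTo ea eb ht
      have := h ⟨_, hs⟩
      have e : a + (b - a) * ((b - a)⁻¹ * t + -((b - a)⁻¹ * a)) = t := by
        field_simp
        ring
      dsimp only at this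
      rw [e] at this
      rw [this, Function.comp_apply, Set.projIcc_val, Set.projIcc_of_mem _ hs]
      rfl

theorem isCarrierOn_of_moore (l : List C.Cell) (hl : l ≠ [])
    (z : ∀ i : Fin l.length, Disk.{u} (C.dim (l.get i)))
    (φ : Fin l.length → C(unitInterval, unitInterval)) (ℓ : Fin l.length → ℝ)
    (hz : ∀ i, ‖(z i).down.1‖ < 1) (hφ : ∀ i, φ i ∈ P.maps) (hℓ : ∀ i, 0 < ℓ i) (a : ℝ)
    (h : ∀ (i : Fin l.length) (s : unitInterval),
      Γ (a + (∑ j ∈ Finset.univ.filter (· < i), ℓ j + ℓ i * s)) =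
        (C.charMap (l.get i)).toMap (GlobSpace.delta (z i) (φ i s))) :
    C.IsCarrierOn Γ a (a + ∑ i, ℓ i) l := by
  induction l generalizing a with
  | nil => exact absurd rfl hl
  | cons c l ih =>
    have hstep : C.IsStep Γ a (a + ℓ 0) c := isStep_iff.2 ⟨by linarith [hℓ 0], z 0, hz 0, φ 0, hφ 0,
      fun s => (congrArg Γ (by simp)).trans (h 0 s)⟩
    have hsum : ∑ i, ℓ i = ℓ 0 + ∑ i : Fin l.length, ℓ i.succ := Fin.sum_univ_succ _
    rcases eq_or_ne l [] with rfl | hl'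
    · have : a + ∑ i, ℓ i = a + ℓ 0 := by rw [hsum]; simp
      rw [this]
      exact .single hstep
    · rw [hsum, ← add_assoc]
      refine .cons hstep (ih hl' (fun i => z i.succ) (fun i => φ i.succ) (fun i => ℓ i.succ)
        (fun i => hz _) (fun i => hφ _) (fun i => hℓ _) _ fun i s => ?_)
      refine (congrArg Γ ?_).trans (h i.succ s)
      have := Fin.sum_filter_lt_succ ℓ i
      refine Eq.trans ?_ (congrArg (fun x => a + (x + ℓ i.succ * (s : ℝ))) this.symm)
      ring

theorem IsCarrierOn.exists_moore (h : C.IsCarrierOn Γ a b l) :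
    ∃ (z : ∀ i : Fin l.length, Disk.{u} (C.dim (l.get i)))
    (φ : Fin l.length → C(unitInterval, unitInterval)) (ℓ : Fin l.length → ℝ),
    (∀ i, ‖(z i).down.1‖ < 1) ∧ (∀ i, φ i ∈ P.maps) ∧ (∀ i, 0 < ℓ i) ∧ ∑ i, ℓ i = b - a ∧
    ∀ (i : Fin l.length) (s : unitInterval),
      Γ (a + (∑ j ∈ Finset.univ.filter (· < i), ℓ j + ℓ i * s)) =
        (C.charMap (l.get i)).toMap (GlobSpace.delta (z i) (φ i s)) := by
  induction h with
  | @single a b c h =>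
    obtain ⟨hab, z, hz, φ, hφ, h⟩ := isStep_iff.1 h
    refine ⟨Fin.cons z finZeroElim, fun _ => φ, fun _ => b - a, ?_, fun _ => hφ,
      fun _ => sub_pos.2 hab, by simp, ?_⟩
    · exact Fin.cases hz finZeroElim
    · refine Fin.cases (fun s => ?_) finZeroElim
      exact (congrArg Γ (by simp)).trans (h s)
  | @cons a b d c l h _ ih =>
    obtain ⟨hab, z, hz, φ, hφ, h⟩ := isStep_iff.1 h
    obtain ⟨zs, φs, ℓ, hzs, hφs, hℓ, hsum, hs⟩ := ih
    refine ⟨Fin.cons z zs, Fin.cons φ φs, Fin.cons (b - a) ℓ, Fin.cases hz hzs, Fin.cases hφ hφs,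
      Fin.cases (sub_pos.2 hab) hℓ, ?_, Fin.cases (fun s => ?_) fun i s => ?_⟩
    · refine (Fin.sum_univ_succ _).trans ?_
      simp [hsum]
    · refine (congrArg Γ ?_).trans (h s)
      simp
    · refine Eq.trans ?_ (hs i s)
      congr 1
      have := Fin.sum_filter_lt_succ (Fin.cons (b - a) ℓ) i
      simp only [Fin.cons_succ, Fin.cons_zero] at this
      refine (congrArg (fun x => a + (x + ℓ i * (s : ℝ))) this).trans ?_
      ring

theorem isCarrier_iff {γ : C(unitInterval, X.carrier)} :
    C.IsCarrier γ l ↔ C.IsCarrierOn (Set.IccExtend zero_le_one γ) 0 1 l := by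
  constructor
  · rintro ⟨hl, z, φ, ℓ, hz, hφ, hℓ, hsum, h⟩
    have := isCarrierOn_of_moore (Γ := Set.IccExtend zero_le_one γ) l hl z φ ℓ hz hφ hℓ 0
      fun i s => ?_
    · rwa [hsum, zero_add] at this
    · have hmem : 0 + (∑ j ∈ Finset.univ.filter (· < i), ℓ j + ℓ i * s) ∈ Set.Icc (0 : ℝ) 1 := by
        have h0 : 0 ≤ ∑ j ∈ Finset.univ.filter (· < i), ℓ j := Finset.sum_nonneg fun j _ => (hℓ j).le
        have h1 : 0 ≤ ℓ i * s := mul_nonneg (hℓ i).le s.2.1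
        have h2 : ℓ i * s ≤ ℓ i := mul_le_of_le_one_right (hℓ i).le s.2.2
        have h3 : ∑ j ∈ Finset.univ.filter (· < i), ℓ j + ℓ i ≤ ∑ j, ℓ j := by
          rw [add_comm, ← Finset.sum_insert (by simp)]
          exact Finset.sum_le_sum_of_subset_of_nonneg (Finset.subset_univ _) fun j _ _ => (hℓ j).le
        constructor <;> linarith
      rw [Set.IccExtend_of_mem _ _ hmem]
      exact h i s _ (zero_add _)
  · intro h
    obtain ⟨z, φ, ℓ, hz, hφ, hℓ, hsum, hs⟩ := h.exists_moore
    refine ⟨h.ne_nil, z, φ, ℓ, hz, hφ, hℓ, by rw [hsum, sub_zero], fun i s t ht => ?_⟩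
    rw [← hs i s, zero_add, ← ht, Set.IccExtend_val]

end MultipointedDSpace.CellularPresentation

theorem IccExtend_normalizedComp_left {X : Type*} [TopologicalSpace X] (γ₁ γ₂ : C(unitInterval, X))
    (h : γ₁ 1 = γ₂ 0) {t : ℝ} (ht : t ∈ Set.Icc (0 : ℝ) (1 / 2)) :
    Set.IccExtend zero_le_one (normalizedComp γ₁ γ₂ h) t =
      Set.IccExtend zero_le_one γ₁ (2 * t + 0) := by
  rw [add_zero, Set.IccExtend_of_mem _ _ ⟨ht.1, by linarith [ht.2]⟩]
  exact if_pos ht.2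

theorem IccExtend_normalizedComp_right {X : Type*} [TopologicalSpace X]
    (γ₁ γ₂ : C(unitInterval, X)) (h : γ₁ 1 = γ₂ 0) {t : ℝ} (ht : t ∈ Set.Icc (1 / 2 : ℝ) 1) :
    Set.IccExtend zero_le_one (normalizedComp γ₁ γ₂ h) t =
      Set.IccExtend zero_le_one γ₂ (2 * t + (-1)) := by
  rcases eq_or_lt_of_le ht.1 with rfl | h'
  · rw [IccExtend_normalizedComp_left γ₁ γ₂ h ⟨by norm_num, le_rfl⟩]
    norm_num
    exact h
  · rw [Set.IccExtend_of_mem _ _ ⟨by linarith, ht.2⟩, ← sub_eq_add_neg]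
    exact if_neg (not_le.2 h')

namespace MultipointedDSpace.CellularPresentation

variable {P : ReparamCategory} {T : SpaceConvention}
  {X : MultipointedDSpace.{u} P T} {J : Type u} [LinearOrder J] [OrderBot J] [SuccOrder J]
  [WellFoundedLT J]

theorem IsCarrier.comp {C : CellularPresentation X J} {γ : C(unitInterval, X.carrier)}
    {l : List C.Cell} (h : C.IsCarrier γ l) {φ : C(unitInterval, unitInterval)} (hφ : φ ∈ P.maps) :
    C.IsCarrier (γ.comp φ) l := by
  rw [isCarrier_iff] at h ⊢
  refine h.reparam zero_le_one (ReparamCategory.IncreasingOn.of_mem_maps hφ)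
    (by simp [ReparamCategory.map_zero hφ]) (by simp [ReparamCategory.map_one hφ]) fun t ht => ?_
  simp [Set.IccExtend]

theorem IsCarrier.normalizedComp {C : CellularPresentation X J} {γ₁ γ₂ : C(unitInterval, X.carrier)}
    {l₁ l₂ : List C.Cell} (h₁ : C.IsCarrier γ₁ l₁) (h₂ : C.IsCarrier γ₂ l₂) (h : γ₁ 1 = γ₂ 0) :
    C.IsCarrier (normalizedComp γ₁ γ₂ h) (l₁ ++ l₂) := by
  rw [isCarrier_iff] at h₁ h₂ ⊢
  exact (h₁.reparam (d' := 1 / 2) (by norm_num) (.affine two_pos 0 _ _) (by norm_num) (by norm_num)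
    fun t ht => IccExtend_normalizedComp_left γ₁ γ₂ h ht).append
    (h₂.reparam (a' := 1 / 2) (by norm_num) (.affine two_pos (-1) _ _) (by norm_num) (by norm_num)
    fun t ht => IccExtend_normalizedComp_right γ₁ γ₂ h ht)

theorem isCarrier_singleton (C : CellularPresentation X J) (c : C.Cell) {z : Disk.{u} (C.dim c)}
    (hz : ‖z.down.1‖ < 1) {φ : C(unitInterval, unitInterval)} (hφ : φ ∈ P.maps) :
    C.IsCarrier ((C.charMap c).toMap.comp ((GlobSpace.delta z).comp φ)) [c] := by
  refine isCarrier_iff.2 (.single (isStep_iff.2 ⟨one_pos, z, hz, φ, hφ, fun s => ?_⟩))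
  rw [sub_zero, one_mul, zero_add, Set.IccExtend_val]
  rfl

/-- The multipointed d-space obtained from `X` by keeping only the execution paths having a
carrier. -/
def carried (C : CellularPresentation X J) : MultipointedDSpace.{u} P T where
  carrier := X.carrier
  holds := X.holds
  states := X.states
  execPaths := {γ | γ ∈ X.execPaths ∧ ∃ l, C.IsCarrier γ l}
  source_mem γ h := X.source_mem γ h.1
  target_mem γ h := X.target_mem γ h.1
  reparam_mem := fun γ ⟨hγ, l, hl⟩ φ hφ => ⟨X.reparam_mem γ hγ φ hφ, l, hl.comp hφ⟩
  comp_mem := fun γ₁ ⟨h₁, l₁, hl₁⟩ γ₂ ⟨h₂, l₂, hl₂⟩ h =>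
    ⟨X.comp_mem γ₁ h₁ γ₂ h₂ h, l₁ ++ l₂, hl₁.normalizedComp hl₂ h⟩

/-- The identity of `X` as a map `carried C ⟶ X`. -/
def carriedHom (C : CellularPresentation X J) : C.carried ⟶ X where
  toMap := ContinuousMap.id _
  map_states _ h := h
  map_execPaths _ h := h.1

theorem exists_charMap_lift (C : CellularPresentation X J) (j : C.Cell)
    (f : C.tower.F.obj j.1 ⟶ C.carried) (hf : f ≫ C.carriedHom = C.tower.incl.app j.1) :
    ∃ v : globDisk P T (C.dim j) ⟶ C.carried, C.attach j ≫ f = globIncl P T (C.dim j) ≫ v ∧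
      v ≫ C.carriedHom = C.charMap j := by
  have hw : C.attach j ≫ C.tower.incl.app j.1 = globIncl P T (C.dim j) ≫ C.charMap j := by
    have := C.tower.incl.naturality (homOfLE (Order.le_succ j.1))
    rw [charMap, ← (C.isPushout j).w_assoc, this.trans (Category.comp_id _)]
  have hw' : ∀ x, f.toMap ((C.attach j).toMap x) =
      (C.charMap j).toMap ((globIncl P T (C.dim j)).toMap x) := fun x => by
    rw [← hf] at hw
    exact DFunLike.congr_fun (congrArg Hom.toMap hw) x
  refine ⟨⟨(C.charMap j).toMap, (C.charMap j).map_states, ?_⟩, hom_ext hw', rfl⟩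
  rintro _ ⟨z, φ, hφ, rfl⟩
  rcases lt_or_eq_of_le (mem_closedBall_zero_iff.1 z.down.2) with hz | hz
  · exact ⟨(C.charMap j).map_execPaths _ ⟨z, φ, hφ, rfl⟩, [j], C.isCarrier_singleton j hz hφ⟩
  · let w : DiskBoundary.{u} (C.dim j) := ⟨⟨z.down.1, mem_sphere_zero_iff_norm.2 hz⟩⟩
    have hmem := f.map_execPaths _ ((C.attach j).map_execPaths
      ((GlobSpace.delta w).comp φ) ⟨w, φ, hφ, rfl⟩)
    convert hmem using 1
    ext t
    exact (hw' (GlobSpace.mk w (φ t))).symm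

theorem exists_isCarrier (C : CellularPresentation X J) {γ : C(unitInterval, X.carrier)}
    (hγ : γ ∈ X.execPaths) : ∃ l, C.IsCarrier γ l := by
  let F := C.tower.F
  obtain ⟨f, hf⟩ : ∃ f : X ⟶ C.carried,
      ∀ j, (C.tower.incl.app j ≫ f) ≫ C.carriedHom = C.tower.incl.app j := by
    refine C.tower.exists_hom_of_good C.carried
      (fun j f => f ≫ C.carriedHom = C.tower.incl.app j) ?_ ?_ ?_
      ⟨(C.tower.incl.app ⊥).toMap, (C.tower.incl.app ⊥).map_states,
        fun γ hγ => (C.tower.isoBot.hom.map_execPaths γ hγ).elim⟩ rfl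
    · intro i j hij f hf
      rw [Category.assoc, hf]
      exact (C.tower.incl.naturality (homOfLE hij)).trans (Category.comp_id _)
    · intro j hj f hf
      obtain ⟨v, hv, hv'⟩ := C.exists_charMap_lift ⟨j, hj⟩ f hf
      have po := C.isPushout ⟨j, hj⟩
      refine ⟨po.desc f v hv, po.hom_ext ?_ ?_, po.inl_desc _ _ _⟩
      · rw [po.inl_desc_assoc, hf]
        exact ((C.tower.incl.naturality (homOfLE (Order.le_succ j))).trans
          (Category.comp_id _)).symm
      · rw [po.inr_desc_assoc, hv']
        rfl
    · intro j hj f hf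
      refine (F.isColimitOfIsWellOrderContinuous j hj).hom_ext fun ⟨i, hi⟩ => ?_
      refine ((Category.assoc _ _ _).symm.trans (hf i hi)).trans ?_
      exact ((C.tower.incl.naturality (homOfLE hi.le)).trans (Category.comp_id _)).symm
  have hid : f ≫ C.carriedHom = 𝟙 X := C.tower.isColimit.hom_ext fun j =>
    ((Category.assoc _ _ _).symm.trans (hf j)).trans (Category.comp_id _).symm
  have : f.toMap.comp γ = γ := by
    ext t
    exact DFunLike.congr_fun (congrArg Hom.toMap hid) (γ t)
  exact this ▸ (f.map_execPaths γ hγ).2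

end MultipointedDSpace.CellularPresentation

/-- `IsTrace N K a b [c₁, …, cₙ]`: the segment `[a,b]` is decomposed into segments contained in `N`,
separated by nonempty open intervals contained in `K c₁`, …, `K cₙ` respectively. -/
inductive IsTrace {ι : Type*} (N : Set ℝ) (K : ι → Set ℝ) : ℝ → ℝ → List ι → Prop
  | nil {a b : ℝ} (hab : a ≤ b) (h : Set.Icc a b ⊆ N) : IsTrace N K a b []
  | cons {a p q b : ℝ} {c : ι} {l : List ι} (hap : a ≤ p) (hpq : p < q) (h : Set.Icc a p ⊆ N)
    (h' : Set.Ioo p q ⊆ K c) (hl : IsTrace N K q b l) : IsTrace N K a b (c :: l)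

namespace IsTrace

variable {ι : Type*} {N : Set ℝ} {K : ι → Set ℝ} {a b d : ℝ} {l l' : List ι}

theorem le (h : IsTrace N K a b l) : a ≤ b := by
  induction h with
  | nil hab => exact hab
  | cons hap hpq _ _ _ ih => exact hap.trans (hpq.le.trans ih)

theorem left_mem (h : IsTrace N K a b l) : a ∈ N := by
  cases h with
  | nil hab h => exact h ⟨le_rfl, hab⟩
  | cons hap hpq h => exact h ⟨le_rfl, hap⟩

theorem extend_left (h : IsTrace N K b d l) (hab : a ≤ b) (hN : Set.Icc a b ⊆ N) :
    IsTrace N K a d l := by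
  have hsub : ∀ {p}, Set.Icc b p ⊆ N → Set.Icc a p ⊆ N := fun {p} hp t ht =>
    (le_total t b).elim (fun h => hN ⟨ht.1, h⟩) fun h => hp ⟨h, ht.2⟩
  cases h with
  | nil hbd h => exact .nil (hab.trans hbd) (hsub h)
  | cons hap hpq h h' hl => exact .cons (hab.trans hap) hpq (hsub h) h' hl

theorem eq_of_disjoint (hN : ∀ c, Disjoint N (K c)) (hK : ∀ c c' t, t ∈ K c → t ∈ K c' → c = c')
    (h : IsTrace N K a b l) (h' : IsTrace N K a b l') : l = l' := by
  have hdisj : ∀ {c t}, t ∈ N → t ∉ K c := fun ht ht' => (hN _).notMem_of_mem_left ht ht'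
  induction h generalizing l' with
  | nil hab h =>
    cases h' with
    | nil => rfl
    | @cons _ p q _ c l hap hpq _ h' hl =>
      obtain ⟨t, ht⟩ := exists_between hpq
      exact absurd (h' ht) (hdisj (h ⟨hap.trans ht.1.le, ht.2.le.trans hl.le⟩))
  | @cons a p q b c l hap hpq hp hq hl ih =>
    cases h' with
    | nil hab h =>
      obtain ⟨t, ht⟩ := exists_between hpq
      exact absurd (hq ht) (hdisj (h ⟨hap.trans ht.1.le, ht.2.le.trans hl.le⟩))
    | @cons _ p' q' _ c' l' hap' hpq' hp' hq' hl' =>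
      have e : p = p' := by
        rcases lt_trichotomy p p' with h | h | h
        · obtain ⟨t, ht⟩ := exists_between (lt_min hpq h)
          exact absurd (hq ⟨ht.1, ht.2.trans_le (min_le_left _ _)⟩)
            (hdisj (hp' ⟨hap.trans ht.1.le, ht.2.le.trans (min_le_right _ _)⟩))
        · exact h
        · obtain ⟨t, ht⟩ := exists_between (lt_min hpq' h)
          exact absurd (hq' ⟨ht.1, ht.2.trans_le (min_le_left _ _)⟩)
            (hdisj (hp ⟨hap'.trans ht.1.le, ht.2.le.trans (min_le_right _ _)⟩))
      subst e
      have e : q = q' := by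
        rcases lt_trichotomy q q' with h | h | h
        · exact absurd (hq' ⟨hpq, h⟩) (hdisj hl.left_mem)
        · exact h
        · exact absurd (hq ⟨hpq', h⟩) (hdisj hl'.left_mem)
      subst e
      obtain ⟨t, ht⟩ := exists_between hpq
      rw [hK c c' t (hq ht) (hq' ht), ih hl']

end IsTrace

namespace MultipointedDSpace.CellularPresentation

variable {P : ReparamCategory} {T : SpaceConvention}
  {X : MultipointedDSpace.{u} P T} {J : Type u} [LinearOrder J] [OrderBot J] [SuccOrder J]
  [WellFoundedLT J]

/-- The open cell of index `c`, as a subset of `X`. -/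
def openCell (C : CellularPresentation X J) (c : C.Cell) : Set X.carrier :=
  {x | ∃ (z : Disk.{u} (C.dim c)) (t : unitInterval), ‖z.down.1‖ < 1 ∧ t ≠ 0 ∧ t ≠ 1 ∧
    x = (C.charMap c).toMap (GlobSpace.mk z t)}

theorem disjoint_states_openCell (C : CellularPresentation X J) (c : C.Cell) :
    Disjoint X.states (C.openCell c) := by
  refine Set.disjoint_left.2 ?_
  rintro _ hx ⟨z, t, hz, h0, h1, rfl⟩
  obtain ⟨f, hf, -⟩ := C.exists_hom_bump c
  have e := congrArg (fun g => Hom.real g (GlobSpace.mk z t)) hf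
  exact (GlobSpace.bump_mk_pos hz h0 h1).ne' (e.symm.trans (Hom.real_state f hx))

theorem disjoint_openCell_of_lt (C : CellularPresentation X J) {j k : C.Cell} (hjk : j < k) :
    Disjoint (C.openCell j) (C.openCell k) := by
  refine Set.disjoint_left.2 ?_
  rintro x ⟨w, s, -, -, -, hx⟩ ⟨z, t, hz, h0, h1, rfl⟩
  obtain ⟨f, hf, hf'⟩ := C.exists_hom_bump k
  have e := congrArg (fun g => Hom.real g (GlobSpace.mk z t)) hf
  have hz0 : C.charMap j ≫ f = zeroHom _ := by
    have := (C.tower.incl.naturality (homOfLE (Order.succ_le_of_lt hjk))).trans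
      (Category.comp_id _)
    rw [charMap, ← this, Category.assoc, Category.assoc, hf']
    rfl
  have e' := congrArg (fun g => Hom.real g (GlobSpace.mk w s)) hz0
  refine (GlobSpace.bump_mk_pos hz h0 h1).ne' (e.symm.trans ?_)
  exact (congrArg (Hom.real f) hx).trans e'

theorem eq_of_mem_openCell (C : CellularPresentation X J) {j k : C.Cell} {x : X.carrier}
    (hj : x ∈ C.openCell j) (hk : x ∈ C.openCell k) : j = k := by
  rcases lt_trichotomy j k with h | h | h
  · exact absurd hk (Set.disjoint_left.1 (C.disjoint_openCell_of_lt h) hj)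
  · exact h
  · exact absurd hj (Set.disjoint_left.1 (C.disjoint_openCell_of_lt h) hk)

variable {C : CellularPresentation X J} {Γ : ℝ → X.carrier} {a b d : ℝ} {c : C.Cell}
  {l l' : List C.Cell}

theorem IsStep.left_mem (h : C.IsStep Γ a b c) : Γ a ∈ X.states := by
  obtain ⟨hab, z, -, ψ, -, h0, -, h⟩ := h
  rw [h a ⟨le_rfl, hab.le⟩, h0, Set.projIcc_left]
  exact (C.charMap c).map_states _ ⟨0, (GlobSpace.mk_zero z).symm⟩

theorem IsStep.exists_trace (h : C.IsStep Γ a b c) : ∃ p q, a ≤ p ∧ p < q ∧ q ≤ b ∧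
    Set.Icc a p ⊆ Γ ⁻¹' X.states ∧ Set.Ioo p q ⊆ Γ ⁻¹' C.openCell c ∧
    Set.Icc q b ⊆ Γ ⁻¹' X.states := by
  obtain ⟨hab, z, hz, ψ, hψ, h0, h1, h⟩ := h
  have hcl : ∀ y : ℝ, IsCompact (Set.Icc a b ∩ ψ ⁻¹' {y}) := fun y =>
    isCompact_Icc.of_isClosed_subset
      (hψ.continuousOn.preimage_isClosed_of_isClosed isClosed_Icc isClosed_singleton)
      Set.inter_subset_left
  obtain ⟨p, ⟨hp, hp0⟩, hpmax⟩ := (hcl 0).exists_isGreatest ⟨a, ⟨le_rfl, hab.le⟩, h0⟩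
  obtain ⟨q, ⟨hq, hq1⟩, hqmin⟩ := (hcl 1).exists_isLeast ⟨b, ⟨hab.le, le_rfl⟩, h1⟩
  rw [Set.mem_preimage, Set.mem_singleton_iff] at hp0 hq1
  have hm := hψ.mapsTo h0 h1
  have hpq : p < q := by
    by_contra! hle
    have := hψ.monotoneOn hq hp hle
    rw [hp0, hq1] at this
    exact absurd this (by norm_num)
  refine ⟨p, q, hp.1, hpq, hq.2, fun t ht => ?_, fun t ht => ?_, fun t ht => ?_⟩
  · have ht' : t ∈ Set.Icc a b := ⟨ht.1, ht.2.trans hp.2⟩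
    have e : ψ t = 0 := le_antisymm (hp0 ▸ hψ.monotoneOn ht' hp ht.2) (hm ht').1
    rw [Set.mem_preimage, h t ht', e, Set.projIcc_left]
    exact (C.charMap c).map_states _ ⟨0, (GlobSpace.mk_zero z).symm⟩
  · have ht' : t ∈ Set.Icc a b := ⟨hp.1.trans ht.1.le, ht.2.le.trans hq.2⟩
    refine ⟨z, _, hz, fun e => ?_, fun e => ?_, h t ht'⟩
    · rw [Set.projIcc_of_mem _ (hm ht')] at e
      exact not_lt.2 (hpmax ⟨ht', congrArg Subtype.val e⟩) ht.1
    · rw [Set.projIcc_of_mem _ (hm ht')] at e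
      exact not_lt.2 (hqmin ⟨ht', congrArg Subtype.val e⟩) ht.2
  · have ht' : t ∈ Set.Icc a b := ⟨hq.1.trans ht.1, ht.2⟩
    have e : ψ t = 1 := le_antisymm (hm ht').2 (hq1 ▸ hψ.monotoneOn hq ht' ht.1)
    rw [Set.mem_preimage, h t ht', e, Set.projIcc_right]
    exact (C.charMap c).map_states _ ⟨1, (GlobSpace.mk_one z).symm⟩

theorem IsStep.exists_apply_eq (h : C.IsStep Γ a b c) : ∃ z : Disk.{u} (C.dim c), ‖z.down.1‖ < 1 ∧
    ∀ s : unitInterval, ∃ t ∈ Set.Icc a b, Γ t = (C.charMap c).toMap (GlobSpace.mk z s) := by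
  obtain ⟨hab, z, hz, ψ, hψ, h0, h1, h⟩ := h
  refine ⟨z, hz, fun s => ?_⟩
  obtain ⟨t, ht, hts⟩ := intermediate_value_Icc hab.le hψ.continuousOn
    (show (s : ℝ) ∈ _ by rw [h0, h1]; exact s.2)
  exact ⟨t, ht, by rw [h t ht, hts, Set.projIcc_val]⟩

theorem IsCarrierOn.isTrace (h : C.IsCarrierOn Γ a b l) :
    IsTrace (Γ ⁻¹' X.states) (fun c => Γ ⁻¹' C.openCell c) a b l := by
  induction h with
  | single h =>
    obtain ⟨p, q, hap, hpq, hqb, h1, h2, h3⟩ := h.exists_trace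
    exact .cons hap hpq h1 h2 (.nil hqb h3)
  | cons h _ ih =>
    obtain ⟨p, q, hap, hpq, hqb, h1, h2, h3⟩ := h.exists_trace
    exact .cons hap hpq h1 h2 (ih.extend_left hqb h3)

theorem IsCarrierOn.unique (h : C.IsCarrierOn Γ a b l) (h' : C.IsCarrierOn Γ a b l') : l = l' :=
  h.isTrace.eq_of_disjoint (fun c => (C.disjoint_states_openCell c).preimage Γ)
    (fun _ _ _ => C.eq_of_mem_openCell) h'.isTrace

theorem existsUnique_isCarrier (C : CellularPresentation X J) {γ : C(unitInterval, X.carrier)}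
    (hγ : γ ∈ X.execPaths) : ∃! l, C.IsCarrier γ l := by
  obtain ⟨l, hl⟩ := C.exists_isCarrier hγ
  exact ⟨l, hl, fun l' hl' => (isCarrier_iff.1 hl').unique (isCarrier_iff.1 hl)⟩

theorem IsCarrierOn.exists_isStep (h : C.IsCarrierOn Γ a b l) (hc : c ∈ l) :
    ∃ a' b', a ≤ a' ∧ b' ≤ b ∧ C.IsStep Γ a' b' c := by
  induction h with
  | @single a b c' h =>
    obtain rfl := List.mem_singleton.1 hc
    exact ⟨a, b, le_rfl, le_rfl, h⟩
  | @cons a b d c' l h h' ih =>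
    rcases List.mem_cons.1 hc with rfl | hc
    · exact ⟨a, b, le_rfl, h'.lt.le, h⟩
    · obtain ⟨a', b', ha, hb, hs⟩ := ih hc
      exact ⟨a', b', h.1.le.trans ha, hb, hs⟩

/-- A function vanishing at the states and reaching `1` on each step bounds the number of steps. -/
theorem IsCarrierOn.length_mul_le (h : C.IsCarrierOn Γ a b l) (f : X ⟶ realLoops P T 1) {δ : ℝ}
    (hδ : ∀ s t : ℝ, |s - t| < δ → |Hom.real f (Γ s) - Hom.real f (Γ t)| < 1) :
    l.length * δ ≤ b - a := by
  have key : ∀ {a b : ℝ} {c : C.Cell}, C.IsStep Γ a b c → δ ≤ b - a := by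
    intro a b c h
    obtain ⟨z, -, hz⟩ := h.exists_apply_eq
    obtain ⟨s, hs⟩ := Hom.exists_le_real f ((C.charMap c).map_execPaths _
      (delta_mem_execPaths _ z))
    obtain ⟨t, ht, hts⟩ := hz s
    have h1 : 1 ≤ Hom.real f (Γ t) := hs.trans_eq (congrArg _ hts.symm)
    have h0 : Hom.real f (Γ a) = 0 := Hom.real_state f h.left_mem
    by_contra! hlt
    have := hδ t a (by rw [abs_of_nonneg (by linarith [ht.1])]; linarith [ht.2])
    rw [h0, sub_zero] at this
    exact absurd (h1.trans (le_abs_self _)) (not_le.2 this)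
  induction h with
  | single h => simpa using key h
  | cons h _ ih =>
    have := key h
    rw [List.length_cons, Nat.cast_succ, add_mul, one_mul]
    linarith

end MultipointedDSpace.CellularPresentation

theorem Set.Finite.setOf_list_length_le {ι : Type*} {S : Set ι} (hS : S.Finite) (n : ℕ) :
    {l : List ι | (∀ c ∈ l, c ∈ S) ∧ l.length ≤ n}.Finite := by
  have : Finite S := hS
  refine ((List.finite_length_le S n).image (List.map Subtype.val)).subset ?_
  rintro l ⟨hl, hn⟩
  lift l to List S using hl
  exact ⟨l, by simpa using hn, rfl⟩

/-- A convergent sequence of paths in `ℝ` is uniformly equicontinuous in the long run. -/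
theorem eventually_uniform_continuity {g : ℕ → C(unitInterval, ℝ)} {g₀ : C(unitInterval, ℝ)}
    (hg : Tendsto g atTop (𝓝 g₀)) : ∃ δ > 0, ∀ᶠ n in atTop, ∀ s t : ℝ, |s - t| < δ →
      |Set.IccExtend zero_le_one (g n) s - Set.IccExtend zero_le_one (g n) t| < 1 := by
  obtain ⟨δ, hδ, h⟩ := Metric.uniformContinuous_iff.1
    (CompactSpace.uniformContinuous_of_continuous g₀.continuous) (1 / 3) (by norm_num)
  refine ⟨δ, hδ, ?_⟩
  filter_upwards [Metric.tendsto_nhds.1 hg (1 / 3) (by norm_num)] with n hn s t hst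
  let s' := Set.projIcc (0 : ℝ) 1 zero_le_one s
  let t' := Set.projIcc (0 : ℝ) 1 zero_le_one t
  have h1 : dist (g₀ s') (g₀ t') < 1 / 3 := h (lt_of_le_of_lt
    (((LipschitzWith.projIcc zero_le_one).dist_le_mul s t).trans (by simp))
    ((Real.dist_eq s t).trans_lt hst))
  have h2 := ((g n).dist_apply_le_dist (g := g₀) s').trans_lt hn
  have h3 := ((g n).dist_apply_le_dist (g := g₀) t').trans_lt hn
  have h4 := dist_triangle4_right (g n s') (g n t') (g₀ s') (g₀ t')
  change |g n s' - g n t'| < 1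
  rw [← Real.dist_eq]
  linarith

namespace MultipointedDSpace.CellularPresentation

variable {P : ReparamCategory} {T : SpaceConvention}
  {X : MultipointedDSpace.{u} P T} {J : Type u} [LinearOrder J] [OrderBot J] [SuccOrder J]
  [WellFoundedLT J]

theorem finite_cells_of_tendsto (C : CellularPresentation X J)
    {γ : ℕ → C(unitInterval, X.carrier)} {γ₀ : C(unitInterval, X.carrier)}
    (hγ : Tendsto γ atTop (𝓝 γ₀)) : {c | ∃ n l, C.IsCarrier (γ n) l ∧ c ∈ l}.Finite := by
  by_contra hS
  set S := {c | ∃ n l, C.IsCarrier (γ n) l ∧ c ∈ l}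
  let half : unitInterval := ⟨1 / 2, by norm_num, by norm_num⟩
  have hz : ∀ c : C.Cell, ∃ z : Disk.{u} (C.dim c), ‖z.down.1‖ < 1 ∧
      (c ∈ S → ∃ n t, γ n t = (C.charMap c).toMap (GlobSpace.mk z half)) := by
    intro c
    by_cases hc : c ∈ S
    · obtain ⟨n, l, hl, hcl⟩ := hc
      obtain ⟨a, b, ha, hb, h⟩ := (isCarrier_iff.1 hl).exists_isStep hcl
      obtain ⟨z, hz, h⟩ := h.exists_apply_eq
      obtain ⟨t, ht, hts⟩ := h half
      exact ⟨z, hz, fun _ => ⟨n, Set.projIcc 0 1 zero_le_one t, hts⟩⟩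
    · exact ⟨⟨⟨0, by simp⟩⟩, by simp, fun h => absurd h hc⟩
  choose z hz1 hz2 using hz
  let e := Set.Infinite.natEmbedding S hS
  have he : Function.Injective fun n => (e n : C.Cell) := Subtype.val_injective.comp e.injective
  obtain ⟨f, hf⟩ := C.exists_hom_value z hz1 half (by simp [half, Subtype.ext_iff])
    (by simp [half, Subtype.ext_iff]) (Function.extend (fun n => (e n : C.Cell)) (fun n => (n : ℝ)) 0)
  have hlim : Tendsto (fun n => (Hom.real f).comp (γ n)) atTop (𝓝 ((Hom.real f).comp γ₀)) :=
    ((ContinuousMap.continuous_postcomp (Hom.real f)).tendsto γ₀).comp hγ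
  obtain ⟨M, hM⟩ := hlim.norm.bddAbove_range
  obtain ⟨m, hm⟩ := exists_nat_gt M
  obtain ⟨n, t, ht⟩ := hz2 _ (e m).2
  have h1 : Hom.real f (γ n t) = m := by
    rw [ht, hf, he.extend_apply]
  have h2 : ‖(Hom.real f).comp (γ n)‖ ≤ M := hM ⟨n, rfl⟩
  have h3 := ((Hom.real f).comp (γ n)).norm_coe_le_norm t
  rw [ContinuousMap.comp_apply, h1, Real.norm_natCast] at h3
  linarith

end MultipointedDSpace.CellularPresentation

theorem mainTheorem10 (P : ReparamCategory) (T : SpaceConvention)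
    (X : MultipointedDSpace.{u} P T)
    (J : Type u) [LinearOrder J] [OrderBot J] [SuccOrder J] [WellFoundedLT J]
    (C : MultipointedDSpace.CellularPresentation X J) (α β : X.states)
    (γ : ℕ → X.ExecPath α β) (γ_infty : X.ExecPath α β)
    (hγ : Tendsto γ atTop (𝓝 γ_infty)) :
    (∀ n, ∃! c : List C.Cell, C.IsCarrier (γ n).1 c) ∧
      {c : List C.Cell | ∃ n, C.IsCarrier (γ n).1 c}.Finite := by
  have huniq : ∀ n, ∃! c : List C.Cell, C.IsCarrier (γ n).1 c := fun n =>
    C.existsUnique_isCarrier (γ n).2.1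
  refine ⟨huniq, ?_⟩
  have hlim : Tendsto (fun n => (γ n).1) atTop (𝓝 γ_infty.1) :=
    (continuous_subtype_val.tendsto _).comp hγ
  choose c hc hcu using huniq
  obtain ⟨f⟩ := C.nonempty_hom_realLoops_one
  obtain ⟨δ, hδ, hev⟩ := eventually_uniform_continuity (g := fun n => f.real.comp (γ n).1)
    (((ContinuousMap.continuous_postcomp f.real).tendsto _).comp hlim)
  have hbdd : BddAbove (Set.range fun n => ((c n).length : ℝ)) := by
    refine IsBoundedUnder.bddAbove_range ⟨1 / δ, eventually_map.2 ?_⟩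
    filter_upwards [hev] with n hn
    have := (MultipointedDSpace.CellularPresentation.isCarrier_iff.1 (hc n)).length_mul_le f hn
    rw [le_div_iff₀ hδ]
    linarith
  obtain ⟨M, hM⟩ := hbdd
  refine ((C.finite_cells_of_tendsto hlim).setOf_list_length_le ⌊M⌋₊).subset ?_
  rintro l ⟨n, hl⟩
  obtain rfl := hcu n l hl
  exact ⟨fun a ha => ⟨n, _, hl, ha⟩, Nat.le_floor (hM ⟨n, rfl⟩)⟩
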